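/- A numerical semigroup is a submonoid $\Gamma$ of $(\mathbb N,+)$, $0\in\mathbb N$, with finite complement in $\mathbb N$. Let $\mathrm c(\Gamma)$ be its conductor, i.e. the least $c\in\mathbb N$ such that every integer $n\ge c$ belongs to $\Gamma$ (one plus the Frobenius number). Let $\{r_0,\dots,r_h\}$ be the unique minimal generating set of $\Gamma$ and let $\mathrm e(\Gamma)=h+1$ be its embedding dimension. A presentation of $\Gamma$ is a subset of $\mathbb N^{h+1}\times\mathbb N^{h+1}$ that generates the kernel congruence $\{(a,b) : \varphi(a)=\varphi(b)\}$ of $\varphi:\mathbb N^{h+1}\to\Gamma$, $\varphi(a_0,\dots,a_h)=a_0r_0+\cdots+a_hr_h$; it is minimal if it is minimal with respect to inclusion among presentations. $\Gamma$ is a complete intersection if it has a minimal presentation with exactly $\mathrm e(\Gamma)-1$ elements. Let $\Gamma^{(0)}=\mathbb N$, $\Gamma^{(1)}=\langle 2,3\rangle$ and $\Gamma^{(n+1)}=2\,\Gamma^{(n)}+(2^{n+1}+1)\mathbb N$ for $n\ge 1$. **Proposition.** For every complete intersection numerical semigroup $\Gamma$, $$(\mathrm e(\Gamma)-1)\,2^{\mathrm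 e(\Gamma)-1}\le \mathrm c(\Gamma),$$ and equality holds if and only if $\Gamma=\Gamma^{(n)}$ for some $n\ge 0$. Moreover, for every $n\ge 0$, $\Gamma^{(n)}$ is a complete intersection numerical semigroup with $\mathrm e(\Gamma^{(n)})=n+1$ and $\mathrm c(\Gamma^{(n)})=n\,2^n$. -/

import Mathlib

/-- A numerical semigroup is a submonoid of `ℕ` with finite complement. -/
def IsNumericalSemigroup (Γ : AddSubmonoid ℕ) : Prop :=
  ((Γ : Set ℕ)ᶜ).Finite

/-- The minimal generators of `Γ`: the nonzero elements of `Γ` that are not a sum of two nonzero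
elements of `Γ`. By `minimal_generating_iff` this is the unique minimal generating system. -/
def minimalGenerators (Γ : AddSubmonoid ℕ) : Set ℕ :=
  {x | x ∈ Γ ∧ x ≠ 0 ∧ ∀ y ∈ Γ, ∀ z ∈ Γ, y + z = x → y = 0 ∨ z = 0}

theorem closure_minimalGenerators (Γ : AddSubmonoid ℕ) :
    AddSubmonoid.closure (minimalGenerators Γ) = Γ := by
  apply le_antisymm
  · exact (AddSubmonoid.closure_le).2 fun x hx => hx.1
  · intro x
    induction x using Nat.strong_induction_on with
    | _ x ih =>
      intro hx
      by_cases hm : x ∈ minimalGenerators Γ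
      · exact AddSubmonoid.subset_closure hm
      by_cases h0 : x = 0
      · subst h0; exact zero_mem _
      have : ∃ y ∈ Γ, ∃ z ∈ Γ, y + z = x ∧ y ≠ 0 ∧ z ≠ 0 := by
        by_contra hcon
        apply hm
        refine ⟨hx, h0, fun y hy z hz hyz => ?_⟩
        by_contra hne
        rw [not_or] at hne
        exact hcon ⟨y, hy, z, hz, hyz, hne.1, hne.2⟩
      obtain ⟨y, hy, z, hz, rfl, hy0, hz0⟩ := this
      exact add_mem (ih y (by omega) hy) (ih z (by omega) hz)

theorem minimalGenerators_subset {Γ : AddSubmonoid ℕ} {A : Set ℕ}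
    (hA : AddSubmonoid.closure A = Γ) : minimalGenerators Γ ⊆ A := by
  have key : ∀ x ∈ AddSubmonoid.closure A, x ∈ minimalGenerators Γ → x ∈ A := by
    intro x hx
    induction hx using AddSubmonoid.closure_induction with
    | mem x hx => exact fun _ => hx
    | zero => exact fun h => absurd rfl h.2.1
    | add y z hy hz ihy ihz =>
      intro h
      rcases h.2.2 y (hA ▸ hy) z (hA ▸ hz) rfl with h0 | h0
      · subst h0; rw [zero_add] at h ⊢; exact ihz h
      · subst h0; rw [add_zero] at h ⊢; exact ihy h
  exact fun x hx => key x (hA ▸ hx.1) hx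

/-- `minimalGenerators Γ` is the unique generating system of `Γ` that is minimal with respect
to inclusion. -/
theorem minimal_generating_iff (Γ : AddSubmonoid ℕ) (A : Set ℕ) :
    Minimal (fun B : Set ℕ => AddSubmonoid.closure B = Γ) A ↔ A = minimalGenerators Γ := by
  constructor
  · intro h
    exact le_antisymm (h.2 (closure_minimalGenerators Γ) (minimalGenerators_subset h.1))
      (minimalGenerators_subset h.1)
  · rintro rfl
    exact ⟨closure_minimalGenerators Γ, fun B hB _ => minimalGenerators_subset hB⟩

theorem minimalGenerators_finite (Γ : AddSubmonoid ℕ) : (minimalGenerators Γ).Finite := by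
  by_cases h : ∃ m ∈ Γ, m ≠ 0
  · obtain ⟨m, hm, hm0⟩ := h
    refine Set.Finite.of_finite_image (f := fun x => (x % m, decide (x ≤ m)))
      (((Set.finite_Iio m).prod (Set.finite_univ (α := Bool))).subset ?_) ?_
    · rintro _ ⟨x, _, rfl⟩
      exact ⟨Nat.mod_lt _ (Nat.pos_of_ne_zero hm0), trivial⟩
    · have key : ∀ x ∈ minimalGenerators Γ, ∀ y ∈ minimalGenerators Γ, x < y →
          x % m = y % m → False := by
        intro x hx y hy hlt hmod
        have hdvd : m ∣ y - x := (Nat.modEq_iff_dvd' hlt.le).1 hmod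
        obtain ⟨k, hk⟩ := hdvd
        have hmem : m * k ∈ Γ := by
          have := Γ.nsmul_mem hm k
          rwa [smul_eq_mul, mul_comm] at this
        rcases hy.2.2 x hx.1 (m * k) hmem (by omega) with h0 | h0
        · exact hx.2.1 h0
        · omega
      intro x hx y hy hxy
      have hmod : x % m = y % m := congrArg Prod.fst hxy
      rcases lt_trichotomy x y with h | h | h
      · exact (key x hx y hy h hmod).elim
      · exact h
      · exact (key y hy x hx h hmod.symm).elim
  · refine Set.Finite.subset Set.finite_empty fun x hx => h ⟨x, hx.1, hx.2.1⟩

/-- The embedding dimension `e(Γ)`: the number of minimal generators. -/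
noncomputable def embeddingDimension (Γ : AddSubmonoid ℕ) : ℕ :=
  (minimalGenerators Γ).ncard

/-- The conductor `c(Γ)`: the least `c` such that every integer `n ≥ c` belongs to `Γ`.
For a numerical semigroup it is one more than the Frobenius number, see
`isGreatest_semigroupConductor_sub_one`. -/
noncomputable def semigroupConductor (Γ : AddSubmonoid ℕ) : ℕ :=
  sInf {c : ℕ | ∀ n, c ≤ n → n ∈ Γ}

/-- `c(Γ) - 1` is the Frobenius number, the largest integer that is not in `Γ`
(it is `-1` for `Γ = ℕ`). -/
theorem isGreatest_semigroupConductor_sub_one {Γ : AddSubmonoid ℕ} (hΓ : IsNumericalSemigroup Γ) :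
    IsGreatest {z : ℤ | ¬ ∃ n ∈ Γ, (n : ℤ) = z} ((semigroupConductor Γ : ℤ) - 1) := by
  have hne : {c : ℕ | ∀ n, c ≤ n → n ∈ Γ}.Nonempty := by
    obtain ⟨b, hb⟩ := hΓ.bddAbove
    refine ⟨b + 1, fun n hn => ?_⟩
    by_contra h
    have := hb (show n ∈ ((Γ : Set ℕ)ᶜ) from h)
    omega
  have hmem : ∀ n, semigroupConductor Γ ≤ n → n ∈ Γ := Nat.sInf_mem hne
  constructor
  · rintro ⟨n, hn, hnz⟩
    have hle : semigroupConductor Γ ≤ n := by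
      refine Nat.sInf_le fun k hk => ?_
      rcases Nat.eq_or_lt_of_le hk with h | h
      · exact h ▸ hn
      · exact hmem k (by omega)
    omega
  · intro z hz
    by_contra hlt
    have h0 : (0 : ℤ) ≤ z := by omega
    exact hz ⟨z.toNat, hmem _ (by omega), Int.toNat_of_nonneg h0⟩

/-- The factorization homomorphism `φ(a) = ∑ r, a r * r` from the free commutative monoid on the
(finitely many) minimal generators `r` of `Γ`. Its image is `Γ`; it is regarded as a map to `ℕ`,
which does not change its kernel. -/
noncomputable def factorizationHom (Γ : AddSubmonoid ℕ) : (minimalGenerators Γ →₀ ℕ) →+ ℕ :=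
  (Finsupp.linearCombination ℕ fun r : minimalGenerators Γ => (r : ℕ)).toAddMonoidHom

/-- A presentation of `Γ`: a set of pairs generating the kernel congruence of `φ`. -/
def IsPresentation (Γ : AddSubmonoid ℕ)
    (ρ : Set ((minimalGenerators Γ →₀ ℕ) × (minimalGenerators Γ →₀ ℕ))) : Prop :=
  addConGen (fun a b => (a, b) ∈ ρ) = AddCon.ker (factorizationHom Γ)

/-- A minimal presentation of `Γ`: a presentation minimal with respect to inclusion. -/
def IsMinimalPresentation (Γ : AddSubmonoid ℕ)
    (ρ : Set ((minimalGenerators Γ →₀ ℕ) × (minimalGenerators Γ →₀ ℕ))) : Prop :=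
  Minimal (IsPresentation Γ) ρ

/-- A complete intersection: a numerical semigroup that has a minimal presentation with
exactly `e(Γ) - 1` elements. -/
def IsCompleteIntersection (Γ : AddSubmonoid ℕ) : Prop :=
  IsNumericalSemigroup Γ ∧
    ∃ ρ, IsMinimalPresentation Γ ρ ∧ ρ.encard + 1 = (embeddingDimension Γ : ℕ∞)

/-- The recursive family `Γ⁽⁰⁾ = ℕ`, `Γ⁽¹⁾ = ⟨2, 3⟩` and
`Γ⁽ᵏ⁺¹⁾ = 2 Γ⁽ᵏ⁾ + (2ᵏ⁺¹ + 1) ℕ` for `k ≥ 1`. -/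
def recursiveFamily : ℕ → AddSubmonoid ℕ
  | 0 => ⊤
  | 1 => AddSubmonoid.closure {2, 3}
  | n + 2 => (recursiveFamily (n + 1)).map (nsmulAddMonoidHom 2) ⊔
      AddSubmonoid.multiples (2 ^ (n + 2) + 1)

/-! A complete intersection other than `ℕ` is a gluing `Γ = aΓ₁ + bΓ₂` of two smaller ones, with `a
∈ Γ₂` and `b ∈ Γ₁` coprime, and the bound follows by induction on the number of relations.

To find the gluing, read the `e - 1` relations as binomials in `e` variables. Krull's height theorem
makes their supports a mixed dominating family (`mixedDominating_of_addConGen`). For such a family,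
contracting columns yields a division of the generators into two parts that is crossed by only one
relation (`MixedDominating.exists_split`). If `a` and `b` are the gcds of the parts, both sides of
the crossing relation have value `ab` (`weight_eq_mul`), and each part divided by its gcd is a
system of the same kind (`restrict`).

Let the parts have `p` and `q` relations. By induction their generators are at least `2^p` and
`2^q`. Since `b` is a sum of at least two generators of `Γ₁`, and likewise `a` in `Γ₂`, one gets `b
≥ 2^(p+1)` and `a ≥ 2^(q+1)`; coprimality gives `(a-1)(b-1) ≥ 2^(p+q+1)`. The lower bound in
Johnson's formula, `c ≥ ac₁ + bc₂ + (a-1)(b-1)`, then gives `c ≥ (p+q+1) 2^(p+q+1)`. Equality forces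
one part to be `ℕ` and the gluing to be a step of the recursion.

For the family itself, explicit relations and binary normal forms give a presentation with `n`
elements, and a dimension count shows that none is smaller. The conductor is at most `n 2^n` by
direct computation and at least that by the general bound. -/

/-! ### Combinatorics of mixed dominating families -/

/-- A family of pairs of finite sets of columns, one pair for each row, is *mixed dominating* if a
set of columns that meets both sets of every row of a nonempty set of rows always has more
elements than this set of rows. -/
def MixedDominating {ι κ : Type} [DecidableEq ι] (P N : κ → Finset ι) : Prop :=
  ∀ (S : Finset κ) (T : Finset ι), S.Nonempty →
    (∀ i ∈ S, (P i ∩ T).Nonempty ∧ (N i ∩ T).Nonempty) → S.card < T.card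

namespace MixedDominating

variable {ι κ : Type} [DecidableEq ι] {P N : κ → Finset ι}

theorem disjoint (h : MixedDominating P N) (i : κ) : Disjoint (P i) (N i) := by
  rw [Finset.disjoint_left]
  intro x hx hx'
  have := h {i} {x} (Finset.singleton_nonempty i) (by
    intro k hk
    obtain rfl := Finset.mem_singleton.1 hk
    exact ⟨⟨x, by simp [hx]⟩, ⟨x, by simp [hx']⟩⟩)
  simp at this

/-- If there are as many rows as columns but one, then some row consists of two singletons. -/
theorem exists_singletons [Fintype ι] [Fintype κ] [Nonempty κ] (h : MixedDominating P N)
    (hP : ∀ i, (P i).Nonempty) (hN : ∀ i, (N i).Nonempty)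
    (hcard : Fintype.card ι = Fintype.card κ + 1) :
    ∃ i j k, j ≠ k ∧ P i = {j} ∧ N i = {k} := by
  -- Otherwise the columns other than `j` meet both sets of every row, although they are only as
  -- many as the rows. By pigeonhole, two columns then share a row.
  have key : ∀ j, ∃ i, P i = {j} ∨ N i = {j} := by
    intro j
    by_contra! hcon
    have := h Finset.univ (Finset.univ.erase j) Finset.univ_nonempty (by
      intro i _
      have aux : ∀ A : Finset ι, A.Nonempty → A ≠ {j} → (A ∩ Finset.univ.erase j).Nonempty := by
        intro A hA hne
        by_contra hemp
        rw [Finset.not_nonempty_iff_eq_empty] at hemp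
        refine hne (hA.subset_singleton_iff.1 fun x hx => ?_)
        by_contra hxj
        have : x ∈ A ∩ Finset.univ.erase j := by simpa [hx] using hxj
        simp [hemp] at this
      exact ⟨aux _ (hP i) (hcon i).1, aux _ (hN i) (hcon i).2⟩)
    rw [Finset.card_erase_of_mem (Finset.mem_univ j), Finset.card_univ, Finset.card_univ] at this
    omega
  choose f hf using key
  obtain ⟨j, k, hjk, hfjk⟩ := Fintype.exists_ne_map_eq_of_card_lt f (by omega)
  have hk := hf k
  rw [← hfjk] at hk
  rcases hf j with h1 | h1 <;> rcases hk with h2 | h2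
  · exact absurd (Finset.singleton_injective (h1.symm.trans h2)) hjk
  · exact ⟨f j, j, k, hjk, h1, h2⟩
  · exact ⟨f j, k, j, hjk.symm, h2, h1⟩
  · exact absurd (Finset.singleton_injective (h1.symm.trans h2)) hjk

/-- If there are as many rows as columns but one, then the columns can be divided in two parts
which separate the two sets of one row, all other rows being concentrated in one of the parts. -/
theorem exists_split [Fintype ι] [Fintype κ] [DecidableEq κ] [Nonempty κ]
    (h : MixedDominating P N) (hP : ∀ i, (P i).Nonempty) (hN : ∀ i, (N i).Nonempty)
    (hcard : Fintype.card ι = Fintype.card κ + 1) :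
    ∃ (A : Finset ι) (i₀ : κ), P i₀ ⊆ A ∧ N i₀ ⊆ Aᶜ ∧
      ∀ i, i ≠ i₀ → P i ∪ N i ⊆ A ∨ P i ∪ N i ⊆ Aᶜ := by
  obtain ⟨n, hn⟩ : ∃ n, Fintype.card κ = n + 1 :=
    ⟨Fintype.card κ - 1, by have := Fintype.card_pos (α := κ); omega⟩
  induction n generalizing ι κ with
  | zero =>
    obtain ⟨i₀, hi₀⟩ := Fintype.card_eq_one_iff.1 (by simpa using hn)
    refine ⟨P i₀, i₀, subset_rfl, ?_, fun i hi => absurd (hi₀ i) hi⟩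
    exact Finset.subset_compl_iff_disjoint_left.2 (h.disjoint i₀)
  | succ n ih =>
    obtain ⟨i, j, k, hjk, hPi, hNi⟩ := h.exists_singletons hP hN hcard
    -- Delete the row `i` and contract the column `k` onto `j`.
    let π : ι → {x // x ≠ k} := fun x => if hx : x = k then ⟨j, hjk⟩ else ⟨x, hx⟩
    have hπj : π j = ⟨j, hjk⟩ := by simp [π, hjk]
    have hπk : π k = ⟨j, hjk⟩ := by simp [π]
    have hκ : Fintype.card {x : κ // x ≠ i} = n + 1 := by
      rw [Fintype.card_subtype_compl, Fintype.card_subtype_eq]; omega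
    have hι : Fintype.card {x : ι // x ≠ k} = n + 2 := by
      rw [Fintype.card_subtype_compl, Fintype.card_subtype_eq]; omega
    have : Nonempty {x : κ // x ≠ i} := Fintype.card_pos_iff.1 (by omega)
    have hdom : MixedDominating (fun x : {x : κ // x ≠ i} => (P x).image π)
        (fun x : {x : κ // x ≠ i} => (N x).image π) := by
      intro S T hS hST
      have hST' : ∀ x ∈ S, (P x ∩ Finset.univ.filter (π · ∈ T)).Nonempty ∧
          (N x ∩ Finset.univ.filter (π · ∈ T)).Nonempty := by
        intro x hx
        obtain ⟨⟨y, hy⟩, z, hz⟩ := hST x hx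
        simp only [Finset.mem_inter, Finset.mem_image] at hy hz
        obtain ⟨⟨y', hy', rfl⟩, hyT⟩ := hy
        obtain ⟨⟨z', hz', rfl⟩, hzT⟩ := hz
        exact ⟨⟨y', by simp [hy', hyT]⟩, ⟨z', by simp [hz', hzT]⟩⟩
      -- If the contracted column is in `T`, the preimage of `T` gains one column, but the deleted
      -- row can be added to `S` as well; otherwise both cardinalities are unchanged.
      by_cases hjT : (⟨j, hjk⟩ : {x // x ≠ k}) ∈ T
      · have hcardT : (Finset.univ.filter (π · ∈ T)).card = T.card + 1 := by
          have : Finset.univ.filter (π · ∈ T) =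
              insert k (T.map (Function.Embedding.subtype _)) := by
            ext x
            by_cases hx : x = k
            · subst hx; simp [hπk, hjT]
            · simp [π, hx]
          rw [this, Finset.card_insert_of_notMem (by simp), Finset.card_map]
        have hlt := h (insert i (S.map (Function.Embedding.subtype _)))
          (Finset.univ.filter (π · ∈ T)) (Finset.insert_nonempty _ _) (by
            intro x hx
            rcases Finset.mem_insert.1 hx with rfl | hx
            · rw [hPi, hNi]
              exact ⟨⟨j, by simp [hπj, hjT]⟩, ⟨k, by simp [hπk, hjT]⟩⟩
            · obtain ⟨y, hy, rfl⟩ := Finset.mem_map.1 hx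
              exact hST' y hy)
        rw [Finset.card_insert_of_notMem (by simp), Finset.card_map, hcardT] at hlt
        omega
      · have hcardT : (Finset.univ.filter (π · ∈ T)).card = T.card := by
          have : Finset.univ.filter (π · ∈ T) = T.map (Function.Embedding.subtype _) := by
            ext x
            by_cases hx : x = k
            · subst hx; simp [hπk, hjT]
            · simp [π, hx]
          rw [this, Finset.card_map]
        have hlt := h (S.map (Function.Embedding.subtype _))
          (Finset.univ.filter (π · ∈ T)) (by simpa using hS) (by
            intro x hx
            obtain ⟨y, hy, rfl⟩ := Finset.mem_map.1 hx
            exact hST' y hy)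
        rwa [Finset.card_map, hcardT] at hlt
    obtain ⟨A, ⟨i₀, hi₀⟩, hPA, hNA, hrest⟩ := ih hdom (fun x => (hP x).image π)
      (fun x => (hN x).image π) (by omega) hκ
    have hpre : ∀ (B : Finset ι) (C : Finset {x // x ≠ k}), B.image π ⊆ C →
        B ⊆ Finset.univ.filter (π · ∈ C) := by
      intro B C hBC x hx
      simpa using hBC (Finset.mem_image_of_mem π hx)
    have hcompl : (Finset.univ.filter (π · ∈ A))ᶜ = Finset.univ.filter (π · ∈ Aᶜ) := by
      ext x; simp
    refine ⟨Finset.univ.filter (π · ∈ A), i₀, hpre _ _ hPA, hcompl ▸ hpre _ _ hNA, ?_⟩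
    intro x hx
    rw [hcompl]
    -- The contracted row stays on one side because `j` and `k` have the same image.
    by_cases hxi : x = i
    · subst hxi
      rw [hPi, hNi]
      by_cases hjA : (⟨j, hjk⟩ : {x // x ≠ k}) ∈ A
      · left
        apply hpre
        intro y hy
        simp only [Finset.mem_image, Finset.mem_union, Finset.mem_singleton] at hy
        obtain ⟨z, rfl | rfl, rfl⟩ := hy
        · rwa [hπj]
        · rwa [hπk]
      · right
        apply hpre
        intro y hy
        simp only [Finset.mem_image, Finset.mem_union, Finset.mem_singleton] at hy
        rw [Finset.mem_compl]
        obtain ⟨z, rfl | rfl, rfl⟩ := hy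
        · rwa [hπj]
        · rwa [hπk]
    · have := hrest ⟨x, hxi⟩ (by simpa using hx)
      simp only [← Finset.image_union] at this
      exact this.imp (hpre _ _) (hpre _ _)

end MixedDominating

/-! ### Coordinate primes, binomial ideals and Krull's height theorem -/

namespace MvPolynomial

variable {ι : Type} [DecidableEq ι]

/-- The prime ideal generated by the variables with index in `s`, defined as the kernel of the
substitution that annihilates these variables. -/
noncomputable def coordinateIdeal (s : Finset ι) : Ideal (MvPolynomial ι ℚ) :=
  RingHom.ker (aeval (fun i => if i ∈ s then (0 : MvPolynomial ι ℚ) else X i))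

instance (s : Finset ι) : (coordinateIdeal s).IsPrime :=
  RingHom.ker_isPrime _

theorem X_mem_coordinateIdeal_iff {s : Finset ι} {i : ι} :
    (X i : MvPolynomial ι ℚ) ∈ coordinateIdeal s ↔ i ∈ s := by
  simp [coordinateIdeal, RingHom.mem_ker]

theorem coordinateIdeal_mono {s t : Finset ι} (h : s ⊆ t) :
    coordinateIdeal s ≤ coordinateIdeal t := by
  intro f hf
  rw [coordinateIdeal, RingHom.mem_ker] at hf ⊢
  have : (aeval (fun i => if i ∈ t then (0 : MvPolynomial ι ℚ) else X i)).comp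
      (aeval (fun i => if i ∈ s then (0 : MvPolynomial ι ℚ) else X i)) =
      aeval (fun i => if i ∈ t then (0 : MvPolynomial ι ℚ) else X i) := by
    ext1 i
    by_cases hi : i ∈ s
    · simp [hi, h hi]
    · simp [hi]
  rw [← this, AlgHom.comp_apply, hf, map_zero]

/-- Adjoining the variables one at a time gives a strictly increasing chain of primes. -/
theorem card_le_height_coordinateIdeal (s : Finset ι) :
    (s.card : ℕ∞) ≤ (coordinateIdeal s).height := by
  induction s using Finset.induction_on with
  | empty => simp
  | insert i s hi ih =>
    rw [Finset.card_insert_of_notMem hi, Nat.cast_add, Nat.cast_one]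
    refine (add_le_add_left ih 1).trans (Ideal.height_add_one_le_of_lt_of_isPrime ?_)
    refine lt_of_le_of_ne (coordinateIdeal_mono (Finset.subset_insert _ _)) fun heq => hi ?_
    rw [← X_mem_coordinateIdeal_iff, heq, X_mem_coordinateIdeal_iff]
    exact Finset.mem_insert_self _ _

theorem coordinateIdeal_univ_le [Fintype ι] {I : Ideal (MvPolynomial ι ℚ)}
    (h : ∀ i, X i ∈ I) : coordinateIdeal Finset.univ ≤ I := by
  intro f hf
  have hz : (aeval (fun i : ι => (0 : MvPolynomial ι ℚ))) f = 0 := by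
    simpa [coordinateIdeal, RingHom.mem_ker] using hf
  have key : ∀ p : MvPolynomial ι ℚ, p - aeval (fun i : ι => (0 : MvPolynomial ι ℚ)) p ∈ I := by
    intro p
    induction p using MvPolynomial.induction_on with
    | C a => simp
    | add p q hp hq => rw [map_add, add_sub_add_comm]; exact add_mem hp hq
    | mul_X p i hp => rw [map_mul, aeval_X, mul_zero, sub_zero]; exact I.mul_mem_left _ (h i)
  have := key f
  rwa [hz, sub_zero] at this

/-- The congruence of exponents whose monomials coincide modulo an ideal. -/
def monomialCon (J : Ideal (MvPolynomial ι ℚ)) : AddCon (ι →₀ ℕ) where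
  r a b := (monomial a 1 - monomial b 1 : MvPolynomial ι ℚ) ∈ J
  iseqv :=
    { refl := fun a => by simp
      symm := fun {a b} h => by rw [← neg_sub]; exact neg_mem h
      trans := fun {a b c} h h' => by
        rw [← sub_add_sub_cancel (monomial a 1) (monomial b 1)]; exact add_mem h h' }
  add' := by
    intro a b c d h h'
    have e : (monomial (a + c) 1 - monomial (b + d) 1 : MvPolynomial ι ℚ) =
        (monomial a 1 - monomial b 1) * monomial c 1 +
          monomial b 1 * (monomial c 1 - monomial d 1) := by
      simp only [sub_mul, mul_sub, monomial_mul, mul_one]; ring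
    change (monomial (a + c) 1 - monomial (b + d) 1 : MvPolynomial ι ℚ) ∈ J
    rw [e]
    exact add_mem (J.mul_mem_right _ h) (J.mul_mem_left _ h')

end MvPolynomial

open MvPolynomial in
/-- The supports of fewer than `card ι` binomials whose exponents generate the kernel congruence
of a positive grading form a mixed dominating family. -/
theorem mixedDominating_of_addConGen {ι κ : Type} [DecidableEq ι] [Fintype ι] [DecidableEq κ]
    [Fintype κ] (r : ι → ℕ) (hr : ∀ i, r i ≠ 0) (P N : κ → ι →₀ ℕ)
    (hP : ∀ i, P i ≠ 0) (hN : ∀ i, N i ≠ 0) (hcard : Fintype.card κ < Fintype.card ι)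
    (hgen : ∀ a b : ι →₀ ℕ, Finsupp.linearCombination ℕ r a = Finsupp.linearCombination ℕ r b →
      addConGen (fun a b => ∃ i, a = P i ∧ b = N i) a b) :
    MixedDominating (fun i => (P i).support) (fun i => (N i).support) := by
  intro S T hS hST
  by_contra! hlt
  let f : κ → MvPolynomial ι ℚ := fun i => monomial (P i) 1 - monomial (N i) 1
  -- Replacing the binomials of `S` by the variables of `T` does not raise the number of generators
  -- if `T` is no larger than `S`. The binomials of `S` remain in the ideal, because both of their
  -- monomials are divisible by variables of `T`.
  let G : Finset (MvPolynomial ι ℚ) := T.image X ∪ Sᶜ.image f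
  let J := Ideal.span (G : Set (MvPolynomial ι ℚ))
  have hGcard : G.card < Fintype.card ι := by
    have h1 : G.card ≤ T.card + Sᶜ.card :=
      (Finset.card_union_le _ _).trans (add_le_add Finset.card_image_le Finset.card_image_le)
    have h2 := Finset.card_add_card_compl S
    omega
  have hXJ : ∀ j ∈ T, (X j : MvPolynomial ι ℚ) ∈ J := fun j hj =>
    Ideal.subset_span (by simp only [G, Finset.coe_union, Finset.coe_image]; left; exact ⟨j, hj, rfl⟩)
  have hmon : ∀ (I : Ideal (MvPolynomial ι ℚ)) (a : ι →₀ ℕ) (j : ι), a j ≠ 0 → X j ∈ I →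
      (monomial a 1 : MvPolynomial ι ℚ) ∈ I := by
    intro I a j hj hX
    have : a = (a - Finsupp.single j 1) + Finsupp.single j 1 := by
      rw [tsub_add_cancel_of_le]
      simpa using Nat.one_le_iff_ne_zero.2 hj
    rw [this, monomial_add_single, pow_one]
    exact I.mul_mem_left _ hX
  have hfJ : ∀ i, f i ∈ J := by
    intro i
    by_cases hi : i ∈ S
    · obtain ⟨⟨x, hx⟩, y, hy⟩ := hST i hi
      simp only [Finset.mem_inter, Finsupp.mem_support_iff] at hx hy
      exact sub_mem (hmon J _ x hx.1 (hXJ x hx.2)) (hmon J _ y hy.1 (hXJ y hy.2))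
    · exact Ideal.subset_span (by
        simp only [G, Finset.coe_union, Finset.coe_image]; right; exact ⟨i, by simpa using hi, rfl⟩)
  have hcon : addConGen (fun a b => ∃ i, a = P i ∧ b = N i) ≤ monomialCon J := by
    rw [AddCon.addConGen_le]
    rintro a b ⟨i, rfl, rfl⟩
    exact hfJ i
  obtain ⟨i, hi⟩ := hS
  obtain ⟨⟨j, hj⟩, -⟩ := hST i hi
  have hjT : j ∈ T := (Finset.mem_inter.1 hj).2
  -- The monomials `X k ^ r j` and `X j ^ r k` have the same degree in the grading `r`, and the
  -- second lies in `J`.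
  have hXpow : ∀ k, (X k : MvPolynomial ι ℚ) ^ r j ∈ J := by
    intro k
    have h1 : (monomial (Finsupp.single k (r j)) 1 - monomial (Finsupp.single j (r k)) 1 :
        MvPolynomial ι ℚ) ∈ J :=
      hcon (hgen _ _ (by simp [mul_comm]))
    have h2 := hmon J (Finsupp.single j (r k)) j (by simpa using hr k) (hXJ j hjT)
    rw [X_pow_eq_monomial]
    simpa using add_mem h1 h2
  -- Every prime over `J` contains all variables. The height of this minimal prime, at least `card
  -- ι`, would then be at most `G.card`.
  have hmin : coordinateIdeal Finset.univ ∈ J.minimalPrimes := by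
    refine ⟨⟨inferInstance, ?_⟩, fun q hq _ => ?_⟩
    · refine Ideal.span_le.2 fun g hg => ?_
      have hX : ∀ k, (X k : MvPolynomial ι ℚ) ∈ coordinateIdeal Finset.univ := fun k =>
        X_mem_coordinateIdeal_iff.2 (Finset.mem_univ k)
      simp only [G, Finset.coe_union, Finset.coe_image] at hg
      rcases hg with ⟨k, _, rfl⟩ | ⟨k, _, rfl⟩
      · exact hX k
      · obtain ⟨x, hx⟩ := Finsupp.ne_iff.1 (hP k)
        obtain ⟨y, hy⟩ := Finsupp.ne_iff.1 (hN k)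
        exact sub_mem (hmon _ _ x (by simpa using hx) (hX x)) (hmon _ _ y (by simpa using hy) (hX y))
    · have := hq.1
      exact coordinateIdeal_univ_le fun k => hq.1.mem_of_pow_mem _ (hq.2 (hXpow k))
  have h1 := Ideal.height_le_card_of_mem_minimalPrimes_span_finset hmin
  have h2 := (card_le_height_coordinateIdeal (Finset.univ : Finset ι)).trans h1
  rw [Finset.card_univ, Nat.cast_le] at h2
  omega

/-! ### Gluings and the arithmetic of the bound -/

theorem mem_of_semigroupConductor_le {Γ : AddSubmonoid ℕ} (hΓ : IsNumericalSemigroup Γ) {n : ℕ}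
    (h : semigroupConductor Γ ≤ n) : n ∈ Γ := by
  by_contra hn
  have : (n : ℤ) ≤ (semigroupConductor Γ : ℤ) - 1 :=
    (isGreatest_semigroupConductor_sub_one hΓ).2 (show ¬ ∃ m ∈ Γ, (m : ℤ) = n by simpa using hn)
  omega

/-- The semigroup generated by finitely many numbers without common divisor is numerical. -/
theorem isNumericalSemigroup_closure_range {ι : Type} (r : ι → ℕ)
    (h : ∀ d, (∀ j, d ∣ r j) → d = 1) :
    IsNumericalSemigroup (AddSubmonoid.closure (Set.range r)) := by
  obtain ⟨n, hn⟩ := Nat.exists_mem_closure_of_ge (Set.range r)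
  have h1 : Nat.setGcd (Set.range r) = 1 := h _ fun j => Nat.setGcd_dvd_of_mem ⟨j, rfl⟩
  refine (Set.finite_Iio n).subset fun m hm => ?_
  by_contra hlt
  exact hm (hn m (by simpa using hlt) (h1 ▸ one_dvd m))

theorem exists_int_combination_eq_one {ι : Type} [Fintype ι] (r : ι → ℕ)
    (h : ∀ d, (∀ j, d ∣ r j) → d = 1) : ∃ z : ι → ℤ, ∑ j, z j * r j = 1 := by
  obtain ⟨z, hz⟩ := Finset.gcd_eq_sum_mul Finset.univ (fun j => (r j : ℤ))
  have h1 : (Finset.univ.gcd fun j => (r j : ℤ)).natAbs = 1 := by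
    refine h _ fun j => ?_
    rw [← Int.natCast_dvd_natCast, Int.natAbs_dvd]
    exact Finset.gcd_dvd (Finset.mem_univ j)
  rcases Int.natAbs_eq_iff.1 h1 with h2 | h2
  · exact ⟨z, by simp_rw [mul_comm (z _)]; rw [← hz, h2]; rfl⟩
  · refine ⟨fun j => -z j, ?_⟩
    simp_rw [neg_mul, mul_comm (z _)]
    rw [Finset.sum_neg_distrib, ← hz, h2]; rfl

/-- The conductor of a gluing is at least the value of Johnson's formula. -/
theorem le_semigroupConductor_of_gluing {Γ Γ₁ Γ₂ : AddSubmonoid ℕ} {a b : ℕ}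
    (hΓ : IsNumericalSemigroup Γ) (hΓ₁ : IsNumericalSemigroup Γ₁) (hΓ₂ : IsNumericalSemigroup Γ₂)
    (ha0 : a ≠ 0) (hab : Nat.Coprime a b) (ha : a ∈ Γ₂) (hb : b ∈ Γ₁)
    (h : ∀ n ∈ Γ, ∃ s ∈ Γ₁, ∃ t ∈ Γ₂, n = a * s + b * t) :
    ((a : ℤ) * semigroupConductor Γ₁ + b * semigroupConductor Γ₂ + (a - 1) * (b - 1)) ≤
      semigroupConductor Γ := by
  obtain ⟨h₁, -⟩ := isGreatest_semigroupConductor_sub_one hΓ₁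
  obtain ⟨h₂, -⟩ := isGreatest_semigroupConductor_sub_one hΓ₂
  obtain ⟨-, h₃⟩ := isGreatest_semigroupConductor_sub_one hΓ
  set F₁ := (semigroupConductor Γ₁ : ℤ) - 1 with hF₁
  set F₂ := (semigroupConductor Γ₂ : ℤ) - 1 with hF₂
  -- If this number were `as + bt`, coprimality would give `t = F₂ + ak` and `s = F₁ + b - bk`. For
  -- `k ≤ 0` this puts `F₂` in `Γ₂`, for `k ≥ 1` it puts `F₁` in `Γ₁`.
  have hmem : (a * F₁ + b * F₂ + a * b : ℤ) ∈ {z : ℤ | ¬ ∃ n ∈ Γ, (n : ℤ) = z} := by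
    rintro ⟨n, hn, hnz⟩
    obtain ⟨s, hs, t, ht, rfl⟩ := h n hn
    push_cast at hnz
    have e : (a : ℤ) * (F₁ + b - s) = b * (t - F₂) := by linarith
    obtain ⟨k, hk⟩ : (a : ℤ) ∣ t - F₂ :=
      (Nat.isCoprime_iff_coprime.2 hab).dvd_of_dvd_mul_left ⟨_, e.symm⟩
    have e' : F₁ + b - s = b * k := by
      rw [hk] at e
      have : (a : ℤ) * (F₁ + b - s) = a * (b * k) := by rw [e]; ring
      exact mul_left_cancel₀ (by exact_mod_cast ha0) this
    rcases le_or_gt k 0 with hk0 | hk0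
    · obtain ⟨m, rfl⟩ : ∃ m : ℕ, k = -m := ⟨(-k).toNat, by omega⟩
      refine h₂ ⟨t + m * a, add_mem ht (by simpa using Γ₂.nsmul_mem ha m), ?_⟩
      push_cast
      linarith
    · obtain ⟨m, rfl⟩ : ∃ m : ℕ, k = m + 1 := ⟨(k - 1).toNat, by omega⟩
      refine h₁ ⟨s + m * b, add_mem hs (by simpa using Γ₁.nsmul_mem hb m), ?_⟩
      push_cast
      linarith
  have := h₃ hmem
  rw [hF₁, hF₂] at this
  linarith

/-- The two lower bounds are both even, so one of them is strict. If it is the one for `b`, the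
product is at least `(2^(q+1) - 1) 2^(p+1) ≥ 2^q 2^(p+1)`, with equality in the last step only for
`q = 0`. -/
theorem two_pow_le_of_coprime {a b p q : ℕ} (hab : Nat.Coprime a b) (ha : 2 ^ (q + 1) ≤ a)
    (hb : 2 ^ (p + 1) ≤ b) :
    2 ^ (p + q + 1) ≤ (a - 1) * (b - 1) ∧
      (2 ^ (p + q + 1) = (a - 1) * (b - 1) →
        (q = 0 ∧ a = 2 ∧ b = 2 ^ (p + 1) + 1) ∨ (p = 0 ∧ b = 2 ∧ a = 2 ^ (q + 1) + 1)) := by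
  have hne : 2 ^ (q + 1) < a ∨ 2 ^ (p + 1) < b := by
    by_contra! hcon
    obtain rfl := le_antisymm hcon.1 ha
    obtain rfl := le_antisymm hcon.2 hb
    have := Nat.eq_one_of_dvd_coprimes hab (dvd_pow_self 2 (Nat.succ_ne_zero q))
      (dvd_pow_self 2 (Nat.succ_ne_zero p))
    omega
  have key : ∀ {a b p q : ℕ}, 2 ^ (q + 1) ≤ a → 2 ^ (p + 1) < b →
      2 ^ (p + q + 1) ≤ (a - 1) * (b - 1) ∧
      (2 ^ (p + q + 1) = (a - 1) * (b - 1) → q = 0 ∧ a = 2 ∧ b = 2 ^ (p + 1) + 1) := by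
    intro a b p q ha hb
    obtain ⟨x, rfl⟩ := Nat.exists_eq_add_of_le ha
    obtain ⟨y, rfl⟩ := Nat.exists_eq_add_of_lt hb
    have hp : 0 < 2 ^ p := by positivity
    obtain ⟨u, hu⟩ : ∃ u, 2 ^ q = u + 1 := ⟨2 ^ q - 1, by have : 0 < 2 ^ q := by positivity
                                                          omega⟩
    have e1 : 2 ^ (q + 1) + x - 1 = 2 * u + 1 + x := by rw [pow_succ]; omega
    have e2 : 2 ^ (p + 1) + y + 1 - 1 = 2 * 2 ^ p + y := by rw [pow_succ]; omega
    have e3 : 2 ^ (p + q + 1) = 2 * 2 ^ p * (u + 1) := by rw [← hu]; ring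
    rw [e1, e2, e3]
    -- The second summand is the excess over the bound; it vanishes only for `u = x = y = 0`.
    have e4 : (2 * u + 1 + x) * (2 * 2 ^ p + y) =
        2 * 2 ^ p * (u + 1) + (2 * 2 ^ p * (u + x) + y * (2 * u + 1 + x)) := by ring
    rw [e4]
    refine ⟨by omega, fun h => ?_⟩
    have h0 : 2 * 2 ^ p * (u + x) = 0 ∧ y * (2 * u + 1 + x) = 0 := by omega
    have hux : u + x = 0 := (Nat.mul_eq_zero.1 h0.1).resolve_left (by omega)
    have hy : y = 0 := (Nat.mul_eq_zero.1 h0.2).resolve_right (by omega)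
    have hq : q = 0 := by
      by_contra hq
      have := Nat.one_lt_two_pow hq
      omega
    subst hq
    exact ⟨rfl, by omega, by omega⟩
  rcases hne with h | h
  · have := key hb h
    rw [mul_comm (a - 1), add_comm p q]
    exact ⟨this.1, fun e => Or.inr (this.2 e)⟩
  · have := key ha h
    exact ⟨this.1, fun e => Or.inl (this.2 e)⟩

theorem conductor_bound_of_gluing {a b p q c₁ c₂ c : ℕ} (hab : Nat.Coprime a b)
    (ha : 2 ^ (q + 1) ≤ a) (hb : 2 ^ (p + 1) ≤ b) (h₁ : p * 2 ^ p ≤ c₁) (h₂ : q * 2 ^ q ≤ c₂)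
    (h : a * c₁ + b * c₂ + (a - 1) * (b - 1) ≤ c) :
    (p + q + 1) * 2 ^ (p + q + 1) ≤ c ∧
      ((p + q + 1) * 2 ^ (p + q + 1) = c → p * 2 ^ p = c₁ ∧ q * 2 ^ q = c₂ ∧
        ((q = 0 ∧ a = 2 ∧ b = 2 ^ (p + 1) + 1) ∨ (p = 0 ∧ b = 2 ∧ a = 2 ^ (q + 1) + 1))) := by
  obtain ⟨h3, h4⟩ := two_pow_le_of_coprime hab ha hb
  have hq : 0 < 2 ^ (q + 1) := by positivity
  have hp : 0 < 2 ^ (p + 1) := by positivity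
  have e1 : 2 ^ (q + 1) * (p * 2 ^ p) = p * 2 ^ (p + q + 1) := by ring
  have e2 : 2 ^ (p + 1) * (q * 2 ^ q) = q * 2 ^ (p + q + 1) := by ring
  have l1 : a * (p * 2 ^ p) ≤ a * c₁ := Nat.mul_le_mul_left _ h₁
  have l2 : b * (q * 2 ^ q) ≤ b * c₂ := Nat.mul_le_mul_left _ h₂
  have m1 := Nat.mul_le_mul_right (p * 2 ^ p) ha
  have m2 := Nat.mul_le_mul_right (q * 2 ^ q) hb
  have e : (p + q + 1) * 2 ^ (p + q + 1) =
      p * 2 ^ (p + q + 1) + q * 2 ^ (p + q + 1) + 2 ^ (p + q + 1) := by ring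
  rw [e]
  refine ⟨by omega, fun hc => ⟨?_, ?_, h4 (by omega)⟩⟩
  · exact Nat.eq_of_mul_eq_mul_left (show 0 < a by omega) (by omega)
  · exact Nat.eq_of_mul_eq_mul_left (show 0 < b by omega) (by omega)

/-- The recursion also covers the separately defined first step, as `⟨2, 3⟩ = 2ℕ + 3ℕ`. -/
theorem recursiveFamily_succ (n : ℕ) :
    recursiveFamily (n + 1) = (recursiveFamily n).map (nsmulAddMonoidHom 2) ⊔
      AddSubmonoid.multiples (2 ^ (n + 1) + 1) := by
  rcases n with _ | n
  · have : (⊤ : AddSubmonoid ℕ) = AddSubmonoid.closure {1} := by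
      rw [eq_comm, eq_top_iff]
      intro x _
      simp
    simp only [recursiveFamily, this, AddMonoidHom.map_mclosure, AddSubmonoid.multiples_eq_closure,
      ← AddSubmonoid.closure_union]
    norm_num [Set.pair_comm]
  · rfl

/-! ### Dominated systems, their splitting and the induction -/

/-- The support of an exponent vector. -/
def exponentSupport {ι : Type} [Fintype ι] (v : ι → ℕ) : Finset ι :=
  Finset.univ.filter (v · ≠ 0)

theorem mem_exponentSupport {ι : Type} [Fintype ι] {v : ι → ℕ} {j : ι} :
    j ∈ exponentSupport v ↔ v j ≠ 0 := by
  simp [exponentSupport]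

/-- The generators `r` of a semigroup together with relations `P i ~ N i`, one less than there are
generators, which span the lattice of all relations, have mixed dominating supports and do not
involve a generator alone. -/
structure IsDominatedSystem {ι κ : Type} [DecidableEq ι] [Fintype ι] [Fintype κ] (r : ι → ℕ)
    (P N : κ → ι → ℕ) : Prop where
  card_eq : Fintype.card ι = Fintype.card κ + 1
  ne_zero : ∀ j, r j ≠ 0
  dominating : MixedDominating (fun i => exponentSupport (P i)) (fun i => exponentSupport (N i))
  two_le_left : ∀ i, 2 ≤ ∑ j, P i j
  two_le_right : ∀ i, 2 ≤ ∑ j, N i j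
  balanced : ∀ i, ∑ j, P i j * r j = ∑ j, N i j * r j
  lattice : ∀ z : ι → ℤ, ∑ j, z j * r j = 0 →
    ∃ n : κ → ℤ, ∀ j, z j = ∑ i, n i * ((P i j : ℤ) - N i j)

theorem sum_subtype_eq_sum {ι M : Type} [Fintype ι] [AddCommMonoid M] {A : Finset ι} {f : ι → M}
    (hf : ∀ j ∉ A, f j = 0) : ∑ j : {j // j ∈ A}, f j = ∑ j, f j := by
  rw [Finset.sum_coe_sort A f]
  exact Finset.sum_subset (Finset.subset_univ A) fun j _ hj => hf j hj

theorem eq_zero_of_support_subset {ι : Type} [Fintype ι] {v : ι → ℕ} {A : Finset ι} (h : exponentSupport v ⊆ A)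
    {j : ι} (hj : j ∉ A) : v j = 0 := by
  by_contra hv
  exact hj (h (mem_exponentSupport.2 hv))

/-- A division of the generators in two parts `A` and `Aᶜ` such that the relation `i₀` expresses an
element of `⟨A⟩` by `Aᶜ` and each other relation involves only one of the parts. -/
structure IsSplit {ι κ : Type} [DecidableEq ι] [Fintype ι] (P N : κ → ι → ℕ) (A : Finset ι) (i₀ : κ) : Prop where
  left : exponentSupport (P i₀) ⊆ A
  right : exponentSupport (N i₀) ⊆ Aᶜ
  other : ∀ i, i ≠ i₀ → exponentSupport (P i) ∪ exponentSupport (N i) ⊆ A ∨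
    exponentSupport (P i) ∪ exponentSupport (N i) ⊆ Aᶜ

theorem IsSplit.swap {ι κ : Type} [DecidableEq ι] [Fintype ι] {P N : κ → ι → ℕ}
    {A : Finset ι} {i₀ : κ} (h : IsSplit P N A i₀) : IsSplit N P Aᶜ i₀ where
  left := h.right
  right := by rw [compl_compl]; exact h.left
  other i hi := by rw [compl_compl, Finset.union_comm]; exact (h.other i hi).symm

namespace IsDominatedSystem

variable {ι κ : Type} [DecidableEq ι] [Fintype ι] [Fintype κ] {r : ι → ℕ}
  {P N : κ → ι → ℕ}

theorem nonempty_left (h : IsDominatedSystem r P N) (i : κ) : (exponentSupport (P i)).Nonempty := by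
  by_contra hcon
  have := h.two_le_left i
  rw [Finset.sum_eq_zero fun j _ => ?_] at this
  · omega
  · by_contra hj
    exact hcon ⟨j, mem_exponentSupport.2 hj⟩

theorem swap (h : IsDominatedSystem r P N) : IsDominatedSystem r N P where
  card_eq := h.card_eq
  ne_zero := h.ne_zero
  dominating S T hS hST := h.dominating S T hS fun i hi => (hST i hi).symm
  two_le_left := h.two_le_right
  two_le_right := h.two_le_left
  balanced i := (h.balanced i).symm
  lattice z hz := by
    obtain ⟨n, hn⟩ := h.lattice z hz
    refine ⟨-n, fun j => (hn j).trans (Finset.sum_congr rfl fun i _ => ?_)⟩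
    simp only [Pi.neg_apply]
    ring

/-- Every relation lattice element is a combination of the given relations in which the relation
`i₀` accounts for the total weight over `A`. -/
theorem exists_combination (h : IsDominatedSystem r P N) {A : Finset ι} {i₀ : κ}
    (hA : IsSplit P N A i₀) (z : ι → ℤ) (hz : ∑ j, z j * r j = 0) :
    ∃ n : κ → ℤ, (∀ j, z j = ∑ i, n i * ((P i j : ℤ) - N i j)) ∧
      ∑ j ∈ A, z j * r j = n i₀ * ∑ j, P i₀ j * r j := by
  obtain ⟨n, hn⟩ := h.lattice z hz
  refine ⟨n, hn, ?_⟩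
  -- Such a row either lies in `A`, where it is balanced, or vanishes on `A`.
  have hrow : ∀ i, i ≠ i₀ → ∑ j ∈ A, ((P i j : ℤ) - N i j) * r j = 0 := by
    intro i hi
    rcases hA.other i hi with hs | hs
    · have hb := h.balanced i
      have : ∑ j ∈ A, ((P i j : ℤ) - N i j) * r j = ∑ j, ((P i j : ℤ) - N i j) * r j := by
        refine Finset.sum_subset (Finset.subset_univ A) fun j _ hj => ?_
        rw [eq_zero_of_support_subset (Finset.union_subset_left hs) hj,
          eq_zero_of_support_subset (Finset.union_subset_right hs) hj]
        simp
      rw [this]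
      simp_rw [sub_mul, Finset.sum_sub_distrib]
      rw [sub_eq_zero]
      exact_mod_cast hb
    · refine Finset.sum_eq_zero fun j hj => ?_
      rw [eq_zero_of_support_subset (Finset.union_subset_left hs) (by simpa using hj),
        eq_zero_of_support_subset (Finset.union_subset_right hs) (by simpa using hj)]
      simp
  have hrow₀ : ∑ j ∈ A, ((P i₀ j : ℤ) - N i₀ j) * r j = ∑ j, P i₀ j * r j := by
    push_cast
    have : ∑ j, (P i₀ j : ℤ) * r j = ∑ j ∈ A, (P i₀ j : ℤ) * r j := by
      refine (Finset.sum_subset (Finset.subset_univ A) fun j _ hj => ?_).symm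
      rw [eq_zero_of_support_subset hA.left hj]
      simp
    rw [this]
    refine Finset.sum_congr rfl fun j hj => ?_
    rw [eq_zero_of_support_subset hA.right (by simpa using hj)]
    simp
  calc ∑ j ∈ A, z j * r j = ∑ j ∈ A, ∑ i, n i * (((P i j : ℤ) - N i j) * r j) := by
        refine Finset.sum_congr rfl fun j _ => ?_
        rw [hn j, Finset.sum_mul]
        exact Finset.sum_congr rfl fun i _ => by ring
    _ = ∑ i, n i * ∑ j ∈ A, ((P i j : ℤ) - N i j) * r j := by
        rw [Finset.sum_comm]
        simp_rw [Finset.mul_sum]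
    _ = n i₀ * ∑ j ∈ A, ((P i₀ j : ℤ) - N i₀ j) * r j := by
        refine Finset.sum_eq_single i₀ (fun i _ hi => ?_) (by simp)
        rw [hrow i hi, mul_zero]
    _ = _ := by rw [hrow₀]

theorem weight_ne_zero (h : IsDominatedSystem r P N) (i : κ) : ∑ j, P i j * r j ≠ 0 := by
  obtain ⟨j, hj⟩ := h.nonempty_left i
  intro h0
  have := (Finset.sum_eq_zero_iff.1 h0) j (Finset.mem_univ j)
  exact (mul_ne_zero (mem_exponentSupport.1 hj) (h.ne_zero j)) this

/-- The relations concentrated in a part of the generators. -/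
abbrev RowsIn (P N : κ → ι → ℕ) (A : Finset ι) : Type :=
  {i : κ // exponentSupport (P i) ∪ exponentSupport (N i) ⊆ A}

theorem card_rowsIn_lt (h : IsDominatedSystem r P N) {A : Finset ι} (hA : A.Nonempty) :
    Fintype.card (RowsIn P N A) < A.card := by
  rw [Fintype.card_subtype]
  by_cases hS : (Finset.univ.filter
      fun i => exponentSupport (P i) ∪ exponentSupport (N i) ⊆ A).Nonempty
  · refine h.dominating _ A hS fun i hi => ?_
    have hs := (Finset.mem_filter.1 hi).2
    rw [Finset.inter_eq_left.2 (Finset.union_subset_left hs),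
      Finset.inter_eq_left.2 (Finset.union_subset_right hs)]
    exact ⟨h.nonempty_left i, h.swap.nonempty_left i⟩
  · rw [Finset.not_nonempty_iff_eq_empty.1 hS, Finset.card_empty]
    exact hA.card_pos

/-- Each part has fewer rows than columns, while the rows of both parts together with `i₀` exhaust
all `|A| + |Aᶜ| - 1` rows. Hence all inequalities are equalities. -/
theorem card_rowsIn (h : IsDominatedSystem r P N) {A : Finset ι} {i₀ : κ}
    (hA : IsSplit P N A i₀) :
    A.card = Fintype.card (RowsIn P N A) + 1 ∧ Aᶜ.card = Fintype.card (RowsIn P N Aᶜ) + 1 ∧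
      Fintype.card κ = Fintype.card (RowsIn P N A) + Fintype.card (RowsIn P N Aᶜ) + 1 := by
  have h1 := h.card_rowsIn_lt ((h.nonempty_left i₀).mono hA.left)
  have h2 := h.card_rowsIn_lt ((h.swap.nonempty_left i₀).mono hA.right)
  have h3 : Fintype.card κ ≤
      Fintype.card (RowsIn P N A) + Fintype.card (RowsIn P N Aᶜ) + 1 := by
    rw [Fintype.card_subtype, Fintype.card_subtype, ← Finset.card_univ]
    classical
    have hsub : (Finset.univ : Finset κ) ⊆ insert i₀
        (Finset.univ.filter (fun i => exponentSupport (P i) ∪ exponentSupport (N i) ⊆ A) ∪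
          Finset.univ.filter (fun i => exponentSupport (P i) ∪ exponentSupport (N i) ⊆ Aᶜ)) := by
      intro i _
      by_cases hi : i = i₀
      · simp [hi]
      · have := hA.other i hi
        simp only [Finset.mem_insert, Finset.mem_union, Finset.mem_filter, Finset.mem_univ,
          true_and]
        exact Or.inr this
    exact (Finset.card_le_card hsub).trans ((Finset.card_insert_le _ _).trans
      (Nat.add_le_add_right (Finset.card_union_le _ _) 1))
  have h4 := Finset.card_add_card_compl A
  have h5 := h.card_eq
  omega

/-- One part of a split system is again such a system. -/
theorem restrict (h : IsDominatedSystem r P N) {A : Finset ι} {i₀ : κ} (hA : IsSplit P N A i₀)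
    {d : ℕ} {r' : {j // j ∈ A} → ℕ} (hr' : ∀ j : {j // j ∈ A}, r j = d * r' j) :
    IsDominatedSystem r' (fun (i : RowsIn P N A) j => P i j) (fun (i : RowsIn P N A) j => N i j) := by
  have hP0 : ∀ i : RowsIn P N A, ∀ j ∉ A, P i j = 0 := fun i j hj =>
    eq_zero_of_support_subset (Finset.union_subset_left i.2) hj
  have hN0 : ∀ i : RowsIn P N A, ∀ j ∉ A, N i j = 0 := fun i j hj =>
    eq_zero_of_support_subset (Finset.union_subset_right i.2) hj
  obtain ⟨x, hx⟩ := (h.nonempty_left i₀).mono hA.left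
  have hd : d ≠ 0 := by
    rintro rfl
    exact h.ne_zero x (by simpa using hr' ⟨x, hx⟩)
  refine ⟨?_, ?_, ?_, ?_, ?_, ?_, ?_⟩
  · rw [Fintype.card_coe]; exact (h.card_rowsIn hA).1
  · intro j hj
    exact h.ne_zero j (by rw [hr', hj, mul_zero])
  · intro S T hS hST
    have := h.dominating (S.map (Function.Embedding.subtype _))
      (T.map (Function.Embedding.subtype _)) (by simpa using hS) (by
        intro i hi
        obtain ⟨y, hy, rfl⟩ := Finset.mem_map.1 hi
        obtain ⟨⟨a, ha⟩, b, hb⟩ := hST y hy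
        simp only [Finset.mem_inter, mem_exponentSupport] at ha hb
        refine ⟨⟨a, ?_⟩, b, ?_⟩
        · simpa [mem_exponentSupport] using ha
        · simpa [mem_exponentSupport] using hb)
    simpa using this
  · intro i
    rw [sum_subtype_eq_sum (hP0 i)]
    exact h.two_le_left i
  · intro i
    rw [sum_subtype_eq_sum (hN0 i)]
    exact h.two_le_right i
  · intro i
    refine Nat.eq_of_mul_eq_mul_left (Nat.pos_of_ne_zero hd) ?_
    have e : ∀ f : ι → ℕ, (∀ j ∉ A, f j = 0) →
        d * ∑ j : {j // j ∈ A}, f j * r' j = ∑ j, f j * r j := by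
      intro f hf
      rw [← sum_subtype_eq_sum (A := A) (f := fun j => f j * r j)
        (fun j hj => by rw [hf j hj, zero_mul]), Finset.mul_sum]
      exact Finset.sum_congr rfl fun j _ => by rw [hr' j]; ring
    rw [e _ (hP0 i), e _ (hN0 i)]
    exact h.balanced i
  · intro z hz
    -- Extended by zero, `z` has weight zero over `A`. The coefficient of `i₀` is therefore zero,
    -- and the rows in `Aᶜ` contribute nothing on `A`.
    let w : ι → ℤ := fun j => if hj : j ∈ A then z ⟨j, hj⟩ else 0
    have hwA : ∀ j : {j // j ∈ A}, w j = z j := fun j => by simp [w]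
    have hw0 : ∀ j ∉ A, w j * r j = 0 := fun j hj => by simp [w, hj]
    have hwsum : ∑ j ∈ A, w j * r j = 0 := by
      rw [← Finset.sum_coe_sort A (fun j => w j * r j)]
      have : ∑ j : {j // j ∈ A}, w j * r j = d * ∑ j : {j // j ∈ A}, z j * r' j := by
        rw [Finset.mul_sum]
        refine Finset.sum_congr rfl fun j _ => ?_
        rw [hwA, hr']
        push_cast
        ring
      rw [this, hz, mul_zero]
    have hwtot : ∑ j, w j * r j = 0 := by
      rw [← hwsum]
      exact (Finset.sum_subset (Finset.subset_univ A) fun j _ hj => hw0 j hj).symm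
    obtain ⟨n, hn, hn₀⟩ := h.exists_combination hA w hwtot
    rw [hwsum] at hn₀
    have hn0 : n i₀ = 0 := by
      rcases mul_eq_zero.1 hn₀.symm with h0 | h0
      · exact h0
      · exact absurd (by exact_mod_cast h0) (h.weight_ne_zero i₀)
    refine ⟨fun i => n i, fun j => ?_⟩
    rw [← hwA, hn]
    have := sum_subtype_eq_sum (A := Finset.univ.filter
      fun i => exponentSupport (P i) ∪ exponentSupport (N i) ⊆ A)
      (f := fun i => n i * ((P i j : ℤ) - N i j)) (by
        intro i hi
        by_cases hi₀ : i = i₀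
        · rw [hi₀, hn0, zero_mul]
        · have hs := (hA.other i hi₀).resolve_left (by simpa using hi)
          rw [eq_zero_of_support_subset (Finset.union_subset_left hs) (by simp),
            eq_zero_of_support_subset (Finset.union_subset_right hs) (by simp)]
          simp)
    rw [← this]
    exact Fintype.sum_equiv (Equiv.subtypeEquivRight (by simp)) _ _ fun i => rfl

end IsDominatedSystem

theorem exists_eq_mul_and_gcd_eq_one {ι : Type} (r : ι → ℕ) {A : Finset ι} (hA : A.Nonempty) :
    ∃ (d : ℕ) (r' : {j // j ∈ A} → ℕ), (∀ j : {j // j ∈ A}, r j = d * r' j) ∧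
      ∀ e, (∀ j, e ∣ r' j) → e = 1 := by
  obtain ⟨g, hg, hg1⟩ := Finset.extract_gcd r hA
  refine ⟨A.gcd r, fun j => g j, fun j => hg j j.2, fun e he => ?_⟩
  have : e ∣ A.gcd g := Finset.dvd_gcd fun j hj => he ⟨j, hj⟩
  rw [hg1] at this
  exact Nat.dvd_one.1 this

theorem sum_mul_eq_of_weight {ι : Type} [Fintype ι] {A : Finset ι} {r v : ι → ℕ} (hv : exponentSupport v ⊆ A)
    {a b : ℕ} (ha : a ≠ 0) {r₁ : {j // j ∈ A} → ℕ} (h₁ : ∀ j : {j // j ∈ A}, r j = a * r₁ j)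
    (hw : ∑ j, v j * r j = a * b) : b = ∑ j : {j // j ∈ A}, v j * r₁ j := by
  refine Nat.eq_of_mul_eq_mul_left (Nat.pos_of_ne_zero ha) ?_
  rw [← hw, Finset.mul_sum, ← sum_subtype_eq_sum (A := A) (fun j hj => by
    rw [eq_zero_of_support_subset hv hj, zero_mul])]
  exact Finset.sum_congr rfl fun j _ => by rw [h₁ j]; ring

namespace IsDominatedSystem

variable {ι κ : Type} [DecidableEq ι] [Fintype ι] [Fintype κ] {r : ι → ℕ} {P N : κ → ι → ℕ}

/-- The common value of both sides of the separating relation of a split system is the product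
of the greatest common divisors of both parts. -/
theorem weight_eq_mul (h : IsDominatedSystem r P N) {A : Finset ι} {i₀ : κ}
    (hA : IsSplit P N A i₀) (hgcd : ∀ d, (∀ j, d ∣ r j) → d = 1) {a b : ℕ}
    {r₁ : {j // j ∈ A} → ℕ} {r₂ : {j // j ∈ Aᶜ} → ℕ} (h₁ : ∀ j : {j // j ∈ A}, r j = a * r₁ j)
    (h₂ : ∀ j : {j // j ∈ Aᶜ}, r j = b * r₂ j) (hg₁ : ∀ e, (∀ j, e ∣ r₁ j) → e = 1)
    (hg₂ : ∀ e, (∀ j, e ∣ r₂ j) → e = 1) :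
    Nat.Coprime a b ∧ ∑ j, P i₀ j * r j = a * b := by
  have hab : Nat.Coprime a b := by
    refine hgcd _ fun j => ?_
    by_cases hj : j ∈ A
    · rw [h₁ ⟨j, hj⟩]; exact (Nat.gcd_dvd_left a b).mul_right _
    · rw [h₂ ⟨j, by simpa using hj⟩]; exact (Nat.gcd_dvd_right a b).mul_right _
  refine ⟨hab, ?_⟩
  apply Nat.dvd_antisymm
  · obtain ⟨u, hu⟩ := exists_int_combination_eq_one r₁ hg₁
    obtain ⟨v, hv⟩ := exists_int_combination_eq_one r₂ hg₂
    -- Bézout coefficients of both parts yield a lattice element of weight `ab` over `A`, which by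
    -- `exists_combination` is a multiple of the weight of `i₀`.
    let w : ι → ℤ := fun j => if hj : j ∈ A then b * u ⟨j, hj⟩ else -(a * v ⟨j, by simpa using hj⟩)
    have hwA : ∑ j ∈ A, w j * r j = a * b := by
      rw [← Finset.sum_coe_sort A (fun j => w j * r j)]
      calc ∑ j : {j // j ∈ A}, w j * r j = a * b * ∑ j, u j * r₁ j := by
            rw [Finset.mul_sum]
            refine Finset.sum_congr rfl fun j _ => ?_
            rw [h₁ j]
            simp only [w, j.2, dif_pos]
            push_cast
            ring
        _ = a * b := by rw [hu, mul_one]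
    have hwB : ∑ j ∈ Aᶜ, w j * r j = -(a * b) := by
      rw [← Finset.sum_coe_sort Aᶜ (fun j => w j * r j)]
      calc ∑ j : {j // j ∈ Aᶜ}, w j * r j = -(a * b) * ∑ j, v j * r₂ j := by
            rw [Finset.mul_sum]
            refine Finset.sum_congr rfl fun j _ => ?_
            have hj : (j : ι) ∉ A := Finset.mem_compl.1 j.2
            rw [h₂ j]
            simp only [w, hj, dif_neg, not_false_eq_true]
            push_cast
            ring
        _ = -(a * b) := by rw [hv, mul_one]
    obtain ⟨n, -, hn⟩ := h.exists_combination hA w (by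
      rw [← Finset.sum_add_sum_compl A, hwA, hwB, add_neg_cancel])
    rw [hwA] at hn
    rw [← Int.natCast_dvd_natCast]
    exact ⟨n i₀, by push_cast at hn ⊢; linarith⟩
  · refine hab.mul_dvd_of_dvd_of_dvd ?_ ?_
    · refine Finset.dvd_sum fun j _ => ?_
      by_cases hj : j ∈ A
      · rw [h₁ ⟨j, hj⟩]; exact (Dvd.intro _ rfl).mul_left _
      · rw [eq_zero_of_support_subset hA.left hj]; simp
    · rw [h.balanced]
      refine Finset.dvd_sum fun j _ => ?_
      by_cases hj : j ∈ Aᶜ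
      · rw [h₂ ⟨j, hj⟩]; exact (Dvd.intro _ rfl).mul_left _
      · rw [eq_zero_of_support_subset hA.right hj]; simp

theorem closure_range_eq_sup {A : Finset ι} {a b : ℕ} {r₁ : {j // j ∈ A} → ℕ}
    {r₂ : {j // j ∈ Aᶜ} → ℕ} (h₁ : ∀ j : {j // j ∈ A}, r j = a * r₁ j)
    (h₂ : ∀ j : {j // j ∈ Aᶜ}, r j = b * r₂ j) :
    AddSubmonoid.closure (Set.range r) =
      (AddSubmonoid.closure (Set.range r₁)).map (nsmulAddMonoidHom a) ⊔
        (AddSubmonoid.closure (Set.range r₂)).map (nsmulAddMonoidHom b) := by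
  rw [AddMonoidHom.map_mclosure, AddMonoidHom.map_mclosure, ← AddSubmonoid.closure_union]
  congr 1
  ext x
  simp only [Set.mem_range, Set.mem_union, Set.mem_image, exists_exists_eq_and,
    nsmulAddMonoidHom_apply, smul_eq_mul]
  constructor
  · rintro ⟨j, rfl⟩
    by_cases hj : j ∈ A
    · exact Or.inl ⟨⟨j, hj⟩, (h₁ _).symm⟩
    · exact Or.inr ⟨⟨j, by simpa using hj⟩, (h₂ _).symm⟩
  · rintro (⟨j, rfl⟩ | ⟨j, rfl⟩)
    · exact ⟨j, h₁ j⟩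
    · exact ⟨j, h₂ j⟩

/-- The generators, the conductor, and the case of equality for a dominated system. -/
theorem bounds (h : IsDominatedSystem r P N) (hgcd : ∀ d, (∀ j, d ∣ r j) → d = 1) :
    (∀ j, 2 ^ Fintype.card κ ≤ r j) ∧
      Fintype.card κ * 2 ^ Fintype.card κ ≤
        semigroupConductor (AddSubmonoid.closure (Set.range r)) ∧
      (Fintype.card κ * 2 ^ Fintype.card κ =
        semigroupConductor (AddSubmonoid.closure (Set.range r)) →
          AddSubmonoid.closure (Set.range r) = recursiveFamily (Fintype.card κ)) := by
  obtain ⟨n, hn⟩ : ∃ n, Fintype.card κ = n := ⟨_, rfl⟩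
  induction n using Nat.strong_induction_on generalizing ι κ with
  | _ n ih =>
  classical
  -- Without relations there is one generator, which is `1` by the gcd condition.
  rcases isEmpty_or_nonempty κ with hκ | hκ
  · have h0 : Fintype.card κ = 0 := Fintype.card_eq_zero
    obtain ⟨j₀, hj₀⟩ := Fintype.card_eq_one_iff.1 (by rw [h.card_eq, h0])
    have h1 : r j₀ = 1 := hgcd _ fun j => by rw [hj₀ j]
    have htop : AddSubmonoid.closure (Set.range r) = ⊤ := by
      rw [eq_top_iff]
      intro x _
      have : (1 : ℕ) ∈ AddSubmonoid.closure (Set.range r) :=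
        AddSubmonoid.subset_closure ⟨j₀, h1⟩
      simpa using (AddSubmonoid.closure (Set.range r)).nsmul_mem this x
    rw [h0, htop]
    exact ⟨fun j => Nat.one_le_iff_ne_zero.2 (h.ne_zero j), by simp, fun _ => rfl⟩
  · obtain ⟨A, i₀, hsl, hsr, hso⟩ := h.dominating.exists_split h.nonempty_left
      h.swap.nonempty_left h.card_eq
    have hA : IsSplit P N A i₀ := ⟨hsl, hsr, hso⟩
    obtain ⟨a, r₁, h₁, hg₁⟩ :=
      exists_eq_mul_and_gcd_eq_one r ((h.nonempty_left i₀).mono hA.left)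
    obtain ⟨b, r₂, h₂, hg₂⟩ :=
      exists_eq_mul_and_gcd_eq_one r ((h.swap.nonempty_left i₀).mono hA.right)
    obtain ⟨hab, hw⟩ := h.weight_eq_mul hA hgcd h₁ h₂ hg₁ hg₂
    have hw0 : a * b ≠ 0 := hw ▸ h.weight_ne_zero i₀
    have ha0 : a ≠ 0 := left_ne_zero_of_mul hw0
    have hb0 : b ≠ 0 := right_ne_zero_of_mul hw0
    have hbsum := sum_mul_eq_of_weight hA.left ha0 h₁ hw
    have hasum := sum_mul_eq_of_weight (b := a) hA.right hb0 h₂ (by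
      rw [← h.balanced, hw, mul_comm])
    obtain ⟨-, -, hcard⟩ := h.card_rowsIn hA
    have hrows : Fintype.card (RowsIn N P Aᶜ) = Fintype.card (RowsIn P N Aᶜ) :=
      Fintype.card_congr (Equiv.subtypeEquivRight fun i => by rw [Finset.union_comm])
    obtain ⟨hm₁, hc₁, he₁⟩ := ih _ (by omega) (h.restrict hA h₁) hg₁ rfl
    -- Exchanging both sides of the relations lets `Aᶜ` take the role of `A`.
    obtain ⟨hm₂, hc₂, he₂⟩ := ih _ (by omega) (h.swap.restrict hA.swap h₂) hg₂ rfl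
    rw [hrows] at hm₂ hc₂ he₂
    rw [hcard]
    set p := Fintype.card (RowsIn P N A)
    set q := Fintype.card (RowsIn P N Aᶜ)
    have hsup := closure_range_eq_sup h₁ h₂
    -- A sum of at least two generators, each at least `2^m`; this is where a relation involving a
    -- generator alone has to be excluded.
    have hlow : ∀ {B : Finset ι} {v : ι → ℕ} {s : {j // j ∈ B} → ℕ} {m : ℕ},
        exponentSupport v ⊆ B → 2 ≤ ∑ j, v j → (∀ j, 2 ^ m ≤ s j) →
        2 ^ (m + 1) ≤ ∑ j : {j // j ∈ B}, v j * s j := by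
      intro B v s m hv hv2 hs
      calc 2 ^ (m + 1) = 2 * 2 ^ m := by ring
        _ ≤ (∑ j : {j // j ∈ B}, v j) * 2 ^ m := by
            rw [sum_subtype_eq_sum fun j hj => eq_zero_of_support_subset hv hj]
            exact Nat.mul_le_mul_right _ hv2
        _ ≤ _ := by
            rw [Finset.sum_mul]
            exact Finset.sum_le_sum fun j _ => Nat.mul_le_mul_left _ (hs j)
    have hb : 2 ^ (p + 1) ≤ b := hbsum ▸ hlow hA.left (h.two_le_left i₀) hm₁
    have ha : 2 ^ (q + 1) ≤ a := hasum ▸ hlow hA.right (h.two_le_right i₀) hm₂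
    have hmem : ∀ {B : Finset ι} (v : ι → ℕ) (s : {j // j ∈ B} → ℕ),
        ∑ j : {j // j ∈ B}, v j * s j ∈ AddSubmonoid.closure (Set.range s) := fun v s =>
      sum_mem fun j _ => by
        simpa using AddSubmonoid.nsmul_mem _
          (AddSubmonoid.subset_closure (Set.mem_range_self (f := s) j)) (v j)
    have hglue := le_semigroupConductor_of_gluing (isNumericalSemigroup_closure_range r hgcd)
      (isNumericalSemigroup_closure_range r₁ hg₁) (isNumericalSemigroup_closure_range r₂ hg₂)
      ha0 hab (hasum ▸ hmem (N i₀) r₂) (hbsum ▸ hmem (P i₀) r₁) (by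
        intro x hx
        rw [hsup, AddSubmonoid.mem_sup] at hx
        obtain ⟨_, ⟨s, hs, rfl⟩, _, ⟨t, ht, rfl⟩, rfl⟩ := hx
        exact ⟨s, hs, t, ht, by simp⟩)
    have hglue' : a * semigroupConductor (AddSubmonoid.closure (Set.range r₁)) +
        b * semigroupConductor (AddSubmonoid.closure (Set.range r₂)) + (a - 1) * (b - 1) ≤
          semigroupConductor (AddSubmonoid.closure (Set.range r)) := by
      zify [Nat.one_le_iff_ne_zero.2 ha0, Nat.one_le_iff_ne_zero.2 hb0]
      exact hglue
    obtain ⟨hbound, heq⟩ := conductor_bound_of_gluing hab ha hb hc₁ hc₂ hglue'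
    refine ⟨fun j => ?_, hbound, fun e => ?_⟩
    · by_cases hj : j ∈ A
      · rw [h₁ ⟨j, hj⟩]
        calc 2 ^ (p + q + 1) = 2 ^ (q + 1) * 2 ^ p := by ring
          _ ≤ _ := Nat.mul_le_mul ha (hm₁ _)
      · rw [h₂ ⟨j, by simpa using hj⟩]
        calc 2 ^ (p + q + 1) = 2 ^ (p + 1) * 2 ^ q := by ring
          _ ≤ _ := Nat.mul_le_mul hb (hm₂ _)
    · obtain ⟨e₁, e₂, hcase⟩ := heq e
      rw [hsup, he₁ e₁, he₂ e₂]
      have htop : ∀ m : ℕ, (recursiveFamily 0).map (nsmulAddMonoidHom m) =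
          AddSubmonoid.multiples m := by
        intro m
        ext x
        simp [recursiveFamily, AddSubmonoid.mem_multiples_iff, mul_comm]
      rcases hcase with ⟨hq, rfl, rfl⟩ | ⟨hp, rfl, rfl⟩
      · rw [hq, htop, add_zero, recursiveFamily_succ]
      · rw [hp, htop, zero_add, sup_comm, recursiveFamily_succ]

end IsDominatedSystem

/-! ### Factorizations and presentations -/

theorem factorizationHom_single (Γ : AddSubmonoid ℕ) (j : minimalGenerators Γ) (n : ℕ) :
    factorizationHom Γ (Finsupp.single j n) = n * j := by
  simp [factorizationHom]

theorem factorizationHom_apply (Γ : AddSubmonoid ℕ) [Fintype (minimalGenerators Γ)]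
    (a : minimalGenerators Γ →₀ ℕ) : factorizationHom Γ a = ∑ j, a j * (j : ℕ) := by
  simp [factorizationHom, Finsupp.linearCombination_apply, Finsupp.sum_fintype]

theorem factorizationHom_mem (Γ : AddSubmonoid ℕ) (a : minimalGenerators Γ →₀ ℕ) :
    factorizationHom Γ a ∈ Γ := by
  induction a using Finsupp.induction_linear with
  | zero => rw [map_zero]; exact zero_mem _
  | add a b ha hb => rw [map_add]; exact add_mem ha hb
  | single j n => rw [factorizationHom_single]; exact Γ.nsmul_mem j.2.1 n

theorem exists_eq_single_add {ι : Type} {a : ι →₀ ℕ} (ha : a ≠ 0) :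
    ∃ (j : ι) (b : ι →₀ ℕ), a = Finsupp.single j 1 + b := by
  obtain ⟨j, hj⟩ := Finsupp.ne_iff.1 ha
  refine ⟨j, a - Finsupp.single j 1, (add_tsub_cancel_of_le ?_).symm⟩
  simpa using Nat.one_le_iff_ne_zero.2 hj

theorem eq_zero_of_factorizationHom_eq_zero {Γ : AddSubmonoid ℕ} {a : minimalGenerators Γ →₀ ℕ}
    (ha : factorizationHom Γ a = 0) : a = 0 := by
  by_contra h
  obtain ⟨j, b, rfl⟩ := exists_eq_single_add h
  rw [map_add, factorizationHom_single] at ha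
  exact j.2.2.1 (by omega)

/-- A minimal generator has only one factorization. -/
theorem eq_single_of_factorizationHom_eq {Γ : AddSubmonoid ℕ} {a : minimalGenerators Γ →₀ ℕ}
    {j : minimalGenerators Γ} (ha : factorizationHom Γ a = j) : a = Finsupp.single j 1 := by
  have h0 : a ≠ 0 := by
    rintro rfl
    exact j.2.2.1 (by rw [← ha, map_zero])
  obtain ⟨k, b, rfl⟩ := exists_eq_single_add h0
  rw [map_add, factorizationHom_single, one_mul] at ha
  rcases j.2.2.2 k k.2.1 _ (factorizationHom_mem Γ b) ha with h | h
  · exact absurd h k.2.2.1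
  · rw [eq_zero_of_factorizationHom_eq_zero h, add_zero]
    rw [h, add_zero] at ha
    rw [Subtype.ext ha]

theorem IsPresentation.balanced {Γ : AddSubmonoid ℕ}
    {ρ : Set ((minimalGenerators Γ →₀ ℕ) × (minimalGenerators Γ →₀ ℕ))}
    (h : IsPresentation Γ ρ) {x} (hx : x ∈ ρ) :
    factorizationHom Γ x.1 = factorizationHom Γ x.2 := by
  have : addConGen (fun a b => (a, b) ∈ ρ) x.1 x.2 := AddConGen.Rel.of _ _ hx
  rw [h] at this
  exact this

theorem IsPresentation.addConGen_of_eq {Γ : AddSubmonoid ℕ}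
    {ρ : Set ((minimalGenerators Γ →₀ ℕ) × (minimalGenerators Γ →₀ ℕ))}
    (h : IsPresentation Γ ρ) {a b : minimalGenerators Γ →₀ ℕ}
    (hab : factorizationHom Γ a = factorizationHom Γ b) :
    addConGen (fun a b => (a, b) ∈ ρ) a b := by
  rw [h]
  exact hab

/-- A trivial pair could be dropped, since congruences are reflexive. -/
theorem IsMinimalPresentation.fst_ne_snd {Γ : AddSubmonoid ℕ}
    {ρ : Set ((minimalGenerators Γ →₀ ℕ) × (minimalGenerators Γ →₀ ℕ))}
    (h : IsMinimalPresentation Γ ρ) {x} (hx : x ∈ ρ) : x.1 ≠ x.2 := by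
  intro heq
  have hpres : IsPresentation Γ (ρ \ {x}) := by
    refine le_antisymm ?_ ?_
    · rw [← h.1, AddCon.addConGen_le]
      exact fun a b hab => AddConGen.Rel.of _ _ hab.1
    · rw [← h.1, AddCon.addConGen_le]
      intro a b hab
      by_cases hx' : (a, b) = x
      · subst hx'
        obtain rfl : a = b := heq
        exact AddCon.refl _ a
      · exact AddConGen.Rel.of _ _ ⟨hab, hx'⟩
  exact (h.2 hpres Set.sdiff_subset hx).2 rfl

/-- The congruence of exponent vectors whose difference is an integral combination of the
differences of given pairs. -/
def latticeCon {ι κ : Type} [Fintype κ] (P N : κ → ι → ℕ) : AddCon (ι →₀ ℕ) where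
  r a b := ∃ n : κ → ℤ, ∀ j, (a j : ℤ) - b j = ∑ i, n i * ((P i j : ℤ) - N i j)
  iseqv :=
    { refl := fun a => ⟨0, fun j => by simp⟩
      symm := fun {a b} ⟨n, hn⟩ => ⟨-n, fun j => by
        simp only [Pi.neg_apply, neg_mul, Finset.sum_neg_distrib, ← hn, neg_sub]⟩
      trans := fun {a b c} ⟨n, hn⟩ ⟨m, hm⟩ => ⟨n + m, fun j => by
        simp only [Pi.add_apply, add_mul, Finset.sum_add_distrib, ← hn, ← hm]; ring⟩ }
  add' := by
    rintro a b c d ⟨n, hn⟩ ⟨m, hm⟩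
    refine ⟨n + m, fun j => ?_⟩
    simp only [Pi.add_apply, add_mul, Finset.sum_add_distrib, ← hn, ← hm, Finsupp.add_apply]
    push_cast
    ring

/-- The positive and negative parts of `z` are factorizations of the same element, and the
congruence generated by `ρ` is contained in `latticeCon`. -/
theorem IsPresentation.lattice {Γ : AddSubmonoid ℕ} [Fintype (minimalGenerators Γ)]
    {ρ : Set ((minimalGenerators Γ →₀ ℕ) × (minimalGenerators Γ →₀ ℕ))} [Fintype ρ]
    (h : IsPresentation Γ ρ) (z : minimalGenerators Γ → ℤ) (hz : ∑ j, z j * ((j : ℕ) : ℤ) = 0) :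
    ∃ n : ρ → ℤ, ∀ j, z j = ∑ i : ρ, n i * ((i.1.1 j : ℤ) - i.1.2 j) := by
  let a : minimalGenerators Γ →₀ ℕ := Finsupp.equivFunOnFinite.symm fun j => (z j).toNat
  let b : minimalGenerators Γ →₀ ℕ := Finsupp.equivFunOnFinite.symm fun j => (-z j).toNat
  have hab : ∀ j, (a j : ℤ) - b j = z j := fun j => Int.toNat_sub_toNat_neg (z j)
  have hφ : factorizationHom Γ a = factorizationHom Γ b := by
    rw [factorizationHom_apply, factorizationHom_apply]
    zify
    rw [← sub_eq_zero, ← Finset.sum_sub_distrib, ← hz]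
    exact Finset.sum_congr rfl fun j _ => by rw [← hab j, sub_mul]
  have hle : addConGen (fun a b => (a, b) ∈ ρ) ≤
      latticeCon (fun (i : ρ) j => i.1.1 j) (fun (i : ρ) j => i.1.2 j) := by
    classical
    rw [AddCon.addConGen_le]
    intro a b hab
    refine ⟨Pi.single ⟨(a, b), hab⟩ 1, fun j => ?_⟩
    rw [Finset.sum_eq_single ⟨(a, b), hab⟩]
    · simp
    · intro i _ hi
      rw [Pi.single_eq_of_ne hi, zero_mul]
    · simp
  obtain ⟨n, hn⟩ := hle (h.addConGen_of_eq hφ)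
  exact ⟨n, fun j => by rw [← hab, hn]⟩

/-- A presentation has at least `e(Γ) - 1` elements. -/
theorem IsPresentation.embeddingDimension_le {Γ : AddSubmonoid ℕ}
    {ρ : Set ((minimalGenerators Γ →₀ ℕ) × (minimalGenerators Γ →₀ ℕ))}
    (h : IsPresentation Γ ρ) (hρ : ρ.Finite) : embeddingDimension Γ ≤ ρ.ncard + 1 := by
  classical
  have := (minimalGenerators_finite Γ).fintype
  have := hρ.fintype
  rw [embeddingDimension, ← Nat.card_coe_set_eq, ← Nat.card_coe_set_eq, Nat.card_eq_fintype_card,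
    Nat.card_eq_fintype_card]
  rcases isEmpty_or_nonempty (minimalGenerators Γ) with he | ⟨⟨j₀⟩⟩
  · rw [Fintype.card_eq_zero]; exact Nat.zero_le _
  -- The differences of the pairs and one unit vector span the whole space, because `j₀ e_j - j
  -- e_{j₀}` is in the lattice of relations for every `j`.
  let v : Option ρ → minimalGenerators Γ → ℚ
    | none => Pi.single j₀ 1
    | some i => fun j => (i.1.1 j : ℚ) - i.1.2 j
  have hspan : Submodule.span ℚ (Set.range v) = ⊤ := by
    rw [eq_top_iff, ← (Pi.basisFun ℚ (minimalGenerators Γ)).span_eq, Submodule.span_le]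
    rintro _ ⟨j, rfl⟩
    rw [Pi.basisFun_apply]
    obtain ⟨n, hn⟩ := h.lattice (Pi.single j ((j₀ : ℕ) : ℤ) - Pi.single j₀ ((j : ℕ) : ℤ)) (by
      simp only [Pi.sub_apply, sub_mul, Finset.sum_sub_distrib, Pi.single_apply, ite_mul, zero_mul,
        Finset.sum_ite_eq', Finset.mem_univ, if_true]
      ring)
    have hj₀ : ((j₀ : ℕ) : ℚ) ≠ 0 := by exact_mod_cast j₀.2.2.1
    have e : (Pi.single j 1 : minimalGenerators Γ → ℚ) =
        ((j₀ : ℕ) : ℚ)⁻¹ • (((j : ℕ) : ℚ) • v none + ∑ i : ρ, (n i : ℚ) • v (some i)) := by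
      rw [eq_inv_smul_iff₀ hj₀]
      ext k
      have hk : ((Pi.single j ((j₀ : ℕ) : ℤ) - Pi.single j₀ ((j : ℕ) : ℤ) :
          minimalGenerators Γ → ℤ) k : ℚ) = ∑ i : ρ, (n i : ℚ) * ((i.1.1 k : ℚ) - i.1.2 k) := by
        rw [hn k]; push_cast; rfl
      simp only [Pi.smul_apply, Pi.add_apply, Finset.sum_apply, smul_eq_mul, v]
      rw [← hk]
      simp only [Pi.sub_apply, Pi.single_apply]
      split_ifs <;> push_cast <;> ring
    rw [e]
    refine Submodule.smul_mem _ _ (add_mem (Submodule.smul_mem _ _ ?_)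
      (sum_mem fun i _ => Submodule.smul_mem _ _ ?_))
    · exact Submodule.subset_span ⟨none, rfl⟩
    · exact Submodule.subset_span ⟨some i, rfl⟩
  have := finrank_range_le_card (R := ℚ) v
  rw [Set.finrank, hspan, finrank_top, Module.finrank_fintype_fun_eq_card,
    Fintype.card_option] at this
  exact this

theorem eq_one_of_forall_dvd_minimalGenerators {Γ : AddSubmonoid ℕ} (hΓ : IsNumericalSemigroup Γ)
    {d : ℕ} (hd : ∀ j : minimalGenerators Γ, d ∣ j) : d = 1 := by
  have key : ∀ x ∈ Γ, d ∣ x := by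
    intro x hx
    rw [← closure_minimalGenerators Γ] at hx
    induction hx using AddSubmonoid.closure_induction with
    | mem x hx => exact hd ⟨x, hx⟩
    | zero => exact dvd_zero d
    | add x y _ _ hx hy => exact dvd_add hx hy
  have h1 := key _ (mem_of_semigroupConductor_le hΓ le_rfl)
  have h2 := key _ (mem_of_semigroupConductor_le hΓ (Nat.le_succ _))
  exact Nat.dvd_one.1 ((Nat.dvd_add_right h1).1 h2)

/-- The zero vector and the unit vectors are the only factorizations of their values. -/
theorem two_le_sum_of_ne {Γ : AddSubmonoid ℕ} [Fintype (minimalGenerators Γ)]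
    {a b : minimalGenerators Γ →₀ ℕ} (hab : factorizationHom Γ a = factorizationHom Γ b)
    (hne : a ≠ b) : 2 ≤ ∑ j, a j := by
  by_contra! hlt
  have h0 : a ≠ 0 := by
    rintro rfl
    rw [map_zero] at hab
    exact hne (eq_zero_of_factorizationHom_eq_zero hab.symm).symm
  obtain ⟨j, c, rfl⟩ := exists_eq_single_add h0
  have hc : c = 0 := by
    simp only [Finsupp.add_apply, Finset.sum_add_distrib, Finsupp.single_apply, Finset.sum_ite_eq,
      Finset.mem_univ, if_true] at hlt
    ext k
    exact (Finset.sum_eq_zero_iff.1 (show ∑ k, c k = 0 by omega)) k (Finset.mem_univ k)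
  subst hc
  rw [add_zero, factorizationHom_single, one_mul] at hab
  exact hne (by rw [add_zero, eq_single_of_factorizationHom_eq hab.symm])

/-- The relations of a minimal presentation of a complete intersection. -/
theorem IsMinimalPresentation.isDominatedSystem {Γ : AddSubmonoid ℕ}
    [Fintype (minimalGenerators Γ)]
    {ρ : Set ((minimalGenerators Γ →₀ ℕ) × (minimalGenerators Γ →₀ ℕ))} [Fintype ρ]
    (h : IsMinimalPresentation Γ ρ)
    (hcard : Fintype.card (minimalGenerators Γ) = Fintype.card ρ + 1) :
    IsDominatedSystem (fun j : minimalGenerators Γ => (j : ℕ))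
      (fun (i : ρ) j => i.1.1 j) (fun (i : ρ) j => i.1.2 j) where
  card_eq := hcard
  ne_zero j := j.2.2.1
  dominating := by
    classical
    have hs : ∀ a : minimalGenerators Γ →₀ ℕ, exponentSupport (fun j => a j) = a.support := by
      intro a; ext j; simp [mem_exponentSupport]
    have hne : ∀ {a b : minimalGenerators Γ →₀ ℕ},
        factorizationHom Γ a = factorizationHom Γ b → a ≠ b → a ≠ 0 := by
      rintro a b hab hne rfl
      have := two_le_sum_of_ne hab hne
      simp at this
    simp only [hs]
    refine mixedDominating_of_addConGen (fun j : minimalGenerators Γ => (j : ℕ))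
      (fun j => j.2.2.1) (fun i : ρ => i.1.1) (fun i : ρ => i.1.2)
      (fun i => hne (h.1.balanced i.2) (h.fst_ne_snd i.2))
      (fun i => hne (h.1.balanced i.2).symm (h.fst_ne_snd i.2).symm) (by omega) ?_
    intro a b hab
    have hrel : (fun a b => ∃ i : ρ, a = i.1.1 ∧ b = i.1.2) = fun a b => (a, b) ∈ ρ := by
      funext a b
      refine propext ⟨?_, fun hab => ⟨⟨(a, b), hab⟩, rfl, rfl⟩⟩
      rintro ⟨i, rfl, rfl⟩
      exact i.2
    rw [hrel]
    exact h.1.addConGen_of_eq hab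
  two_le_left i := two_le_sum_of_ne (h.1.balanced i.2) (h.fst_ne_snd i.2)
  two_le_right i := two_le_sum_of_ne (h.1.balanced i.2).symm (h.fst_ne_snd i.2).symm
  balanced i := by
    have := h.1.balanced i.2
    rwa [factorizationHom_apply, factorizationHom_apply] at this
  lattice z hz := h.1.lattice z hz

theorem IsCompleteIntersection.conductor_bound {Γ : AddSubmonoid ℕ}
    (h : IsCompleteIntersection Γ) :
    (embeddingDimension Γ - 1) * 2 ^ (embeddingDimension Γ - 1) ≤ semigroupConductor Γ ∧
      ((embeddingDimension Γ - 1) * 2 ^ (embeddingDimension Γ - 1) = semigroupConductor Γ →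
        Γ = recursiveFamily (embeddingDimension Γ - 1)) := by
  obtain ⟨hΓ, ρ, hρ, hcard⟩ := h
  have := (minimalGenerators_finite Γ).fintype
  have hfin : ρ.Finite := by
    rw [← Set.encard_lt_top_iff]
    refine lt_of_le_of_lt le_self_add (b := ρ.encard + 1) ?_
    rw [hcard]
    exact ENat.natCast_lt_top _
  have := hfin.fintype
  have hcard' : embeddingDimension Γ = Fintype.card ρ + 1 := by
    rw [← hfin.cast_ncard_eq] at hcard
    rw [← Nat.card_eq_fintype_card, Nat.card_coe_set_eq]
    exact_mod_cast hcard.symm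
  have hsys := hρ.isDominatedSystem (by
    rw [← hcard', embeddingDimension, ← Nat.card_eq_fintype_card, Nat.card_coe_set_eq])
  obtain ⟨-, h1, h2⟩ := hsys.bounds fun d hd => eq_one_of_forall_dvd_minimalGenerators hΓ hd
  rw [Subtype.range_coe, closure_minimalGenerators] at h1 h2
  rw [hcard', Nat.add_sub_cancel]
  exact ⟨h1, h2⟩

/-! ### The recursive family -/

/-- The minimal generators `2ⁿ` and `2ⁿ + 2ⁱ`, `i < n`, of the `n`-th member of the recursive
family. -/
def recursiveGenerators (n : ℕ) : Finset ℕ :=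
  insert (2 ^ n) ((Finset.range n).image (2 ^ n + 2 ^ ·))

theorem pow_mem_recursiveGenerators (n : ℕ) : 2 ^ n ∈ recursiveGenerators n :=
  Finset.mem_insert_self _ _

theorem pow_add_pow_mem_recursiveGenerators {n i : ℕ} (hi : i < n) :
    2 ^ n + 2 ^ i ∈ recursiveGenerators n :=
  Finset.mem_insert_of_mem (Finset.mem_image_of_mem (2 ^ n + 2 ^ ·) (Finset.mem_range.2 hi))

theorem card_recursiveGenerators (n : ℕ) : (recursiveGenerators n).card = n + 1 := by
  rw [recursiveGenerators, Finset.card_insert_of_notMem, Finset.card_image_of_injective,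
    Finset.card_range]
  · intro i j hij
    exact Nat.pow_right_injective le_rfl (Nat.add_left_cancel hij)
  · simp

theorem recursiveFamily_eq_closure (n : ℕ) :
    recursiveFamily n = AddSubmonoid.closure (recursiveGenerators n : Set ℕ) := by
  induction n with
  | zero =>
    rw [eq_comm, recursiveFamily, eq_top_iff]
    intro x _
    have h1 : 1 ∈ AddSubmonoid.closure (recursiveGenerators 0 : Set ℕ) :=
      AddSubmonoid.subset_closure (pow_mem_recursiveGenerators 0)
    simpa using AddSubmonoid.nsmul_mem _ h1 x
  | succ n ih =>
    rw [recursiveFamily_succ, ih, AddMonoidHom.map_mclosure, AddSubmonoid.multiples_eq_closure,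
      ← AddSubmonoid.closure_union]
    congr 1
    ext x
    simp only [recursiveGenerators, Finset.coe_insert, Finset.coe_image, Finset.coe_range,
      Set.mem_union, Set.mem_image, Set.mem_insert_iff, Set.mem_singleton_iff, Set.mem_Iio,
      nsmulAddMonoidHom_apply, smul_eq_mul]
    constructor
    · rintro (⟨y, rfl | ⟨i, hi, rfl⟩, rfl⟩ | rfl)
      · exact Or.inl (by ring)
      · exact Or.inr ⟨i + 1, by omega, by ring⟩
      · exact Or.inr ⟨0, by omega, by simp⟩
    · rintro (rfl | ⟨i, hi, rfl⟩)
      · exact Or.inl ⟨2 ^ n, Or.inl rfl, by ring⟩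
      · rcases i with _ | i
        · exact Or.inr (by simp)
        · exact Or.inl ⟨2 ^ n + 2 ^ i, Or.inr ⟨i, by omega, rfl⟩, by ring⟩

theorem mem_recursiveGenerators_bounds {n x : ℕ} (hx : x ∈ recursiveGenerators n) :
    2 ^ n ≤ x ∧ x < 2 ^ (n + 1) := by
  simp only [recursiveGenerators, Finset.mem_insert, Finset.mem_image, Finset.mem_range] at hx
  have hn : 0 < 2 ^ n := by positivity
  rw [pow_succ]
  rcases hx with rfl | ⟨i, hi, rfl⟩
  · omega
  · have : 2 ^ i < 2 ^ n := Nat.pow_lt_pow_right (by norm_num) hi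
    exact ⟨Nat.le_add_right _ _, by linarith⟩

/-- The listed generators are below `2^(n+1)`, whereas a sum of two nonzero elements is at least
`2^(n+1)`. -/
theorem minimalGenerators_recursiveFamily (n : ℕ) :
    minimalGenerators (recursiveFamily n) = recursiveGenerators n := by
  refine le_antisymm (minimalGenerators_subset (recursiveFamily_eq_closure n).symm) fun x hx => ?_
  obtain ⟨h1, h2⟩ := mem_recursiveGenerators_bounds hx
  have hn : 0 < 2 ^ n := by positivity
  have hlow : ∀ y ∈ recursiveFamily n, y ≠ 0 → 2 ^ n ≤ y := by
    intro y hy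
    rw [recursiveFamily_eq_closure] at hy
    induction hy using AddSubmonoid.closure_induction with
    | mem y hy => exact fun _ => (mem_recursiveGenerators_bounds hy).1
    | zero => exact fun h => absurd rfl h
    | add y z _ _ hy hz => omega
  refine ⟨recursiveFamily_eq_closure n ▸ AddSubmonoid.subset_closure hx, by omega, ?_⟩
  intro y hy z hz hyz
  by_contra! hcon
  have := hlow y hy hcon.1
  have := hlow z hz hcon.2
  rw [pow_succ] at h2
  omega

theorem embeddingDimension_recursiveFamily (n : ℕ) :
    embeddingDimension (recursiveFamily n) = n + 1 := by
  rw [embeddingDimension, minimalGenerators_recursiveFamily, Set.ncard_coe_finset,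
    card_recursiveGenerators]

theorem mem_recursiveFamily_of_le (n : ℕ) : ∀ x, n * 2 ^ n ≤ x → x ∈ recursiveFamily n := by
  induction n with
  | zero => exact fun x _ => AddSubmonoid.mem_top x
  | succ n ih =>
    intro x hx
    rw [recursiveFamily_succ, AddSubmonoid.mem_sup]
    have e : (n + 1) * 2 ^ (n + 1) = 2 * (n * 2 ^ n) + 2 ^ (n + 1) := by ring
    have e' : 2 ^ (n + 1) = 2 * 2 ^ n := by ring
    rcases Nat.even_or_odd' x with ⟨y, rfl | rfl⟩
    · exact ⟨2 * y, ⟨y, ih y (by omega), by simp⟩, 0, zero_mem _, by simp⟩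
    -- One copy of the odd generator corrects the parity; the bound on `x` leaves `y - 2ⁿ ≥ n 2ⁿ`.
    · refine ⟨2 * (y - 2 ^ n), ⟨y - 2 ^ n, ih _ (by omega), by simp⟩, 2 ^ (n + 1) + 1,
        AddSubmonoid.mem_multiples _, by omega⟩

theorem isNumericalSemigroup_recursiveFamily (n : ℕ) :
    IsNumericalSemigroup (recursiveFamily n) := by
  refine (Set.finite_Iio (n * 2 ^ n)).subset fun x hx => ?_
  by_contra hlt
  exact hx (mem_recursiveFamily_of_le n x (by simpa using hlt))

open Classical in
/-- The exponent vector of a minimal generator, extended by zero to all numbers. -/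
noncomputable def generatorExponent (Γ : AddSubmonoid ℕ) (x : ℕ) : minimalGenerators Γ →₀ ℕ :=
  if hx : x ∈ minimalGenerators Γ then Finsupp.single ⟨x, hx⟩ 1 else 0

theorem factorizationHom_generatorExponent {Γ : AddSubmonoid ℕ} {x : ℕ}
    (hx : x ∈ minimalGenerators Γ) : factorizationHom Γ (generatorExponent Γ x) = x := by
  rw [generatorExponent, dif_pos hx, factorizationHom_single, one_mul]

/-- The defining relations `2 (2ⁿ + 2ⁱ) = (2ⁿ + 2ⁱ⁺¹) + 2ⁿ`, `i + 1 < n`, and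
`2 (2ⁿ + 2ⁿ⁻¹) = 3 · 2ⁿ`. -/
noncomputable def recursiveRelation (n i : ℕ) :
    (minimalGenerators (recursiveFamily n) →₀ ℕ) × (minimalGenerators (recursiveFamily n) →₀ ℕ) :=
  let E := generatorExponent (recursiveFamily n)
  (2 • E (2 ^ n + 2 ^ i),
    -- For `i + 1 = n` the number `2ⁿ + 2ⁱ⁺¹` is `2 · 2ⁿ`, not a minimal generator, and `E` would
    -- take the default value zero there.
    if i + 1 = n then 3 • E (2 ^ n) else E (2 ^ n + 2 ^ (i + 1)) + E (2 ^ n))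

/-- The factorizations in which all minimal generators but `2ⁿ` occur at most once. -/
noncomputable def normalFactorization (n c : ℕ) (S : Finset ℕ) :
    minimalGenerators (recursiveFamily n) →₀ ℕ :=
  c • generatorExponent (recursiveFamily n) (2 ^ n) +
    ∑ i ∈ S, generatorExponent (recursiveFamily n) (2 ^ n + 2 ^ i)

theorem factorizationHom_pow (n : ℕ) :
    factorizationHom _ (generatorExponent (recursiveFamily n) (2 ^ n)) = 2 ^ n :=
  factorizationHom_generatorExponent (by
    rw [minimalGenerators_recursiveFamily]; exact pow_mem_recursiveGenerators n)

theorem factorizationHom_pow_add_pow {n i : ℕ} (hi : i < n) :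
    factorizationHom _ (generatorExponent (recursiveFamily n) (2 ^ n + 2 ^ i)) = 2 ^ n + 2 ^ i :=
  factorizationHom_generatorExponent (by
    rw [minimalGenerators_recursiveFamily]; exact pow_add_pow_mem_recursiveGenerators hi)

/-- The value is `(c + |S|) 2ⁿ + ∑ 2ⁱ` over `i ∈ S`. Its remainder modulo `2ⁿ` has binary digits
`S`, and the quotient then determines `c`. -/
theorem normalFactorization_injective {n c d : ℕ} {S T : Finset ℕ} (hS : S ⊆ Finset.range n)
    (hT : T ⊆ Finset.range n)
    (h : factorizationHom _ (normalFactorization n c S) =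
      factorizationHom _ (normalFactorization n d T)) :
    normalFactorization n c S = normalFactorization n d T := by
  have key : ∀ (c : ℕ) (S : Finset ℕ), S ⊆ Finset.range n →
      factorizationHom _ (normalFactorization n c S) = (c + S.card) * 2 ^ n + ∑ i ∈ S, 2 ^ i ∧
        ∑ i ∈ S, 2 ^ i < 2 ^ n := by
    intro c S hS
    constructor
    · rw [normalFactorization, map_add, map_nsmul, map_sum, factorizationHom_pow,
        Finset.sum_congr rfl fun i hi => factorizationHom_pow_add_pow (Finset.mem_range.1 (hS hi)),
        Finset.sum_add_distrib, Finset.sum_const]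
      simp only [smul_eq_mul]
      ring
    · exact Nat.geomSum_lt le_rfl fun i hi => Finset.mem_range.1 (hS hi)
  obtain ⟨e1, l1⟩ := key c S hS
  obtain ⟨e2, l2⟩ := key d T hT
  rw [e1, e2] at h
  have hmod := congrArg (· % 2 ^ n) h
  simp only [Nat.mul_add_mod_self_right, Nat.mod_eq_of_lt l1, Nat.mod_eq_of_lt l2] at hmod
  obtain rfl : S = T := Finset.geomSum_injective le_rfl hmod
  have hmul := Nat.eq_of_mul_eq_mul_right (by positivity) (Nat.add_right_cancel h)
  rw [Nat.add_right_cancel hmul]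

/-- Adding the generator `2ⁿ + 2ⁱ` to a normal form is a binary addition of `2ⁱ`: if the digit `i`
is already set, the relation carries to `i + 1`, and at the top digit into copies of `2ⁿ`. -/
theorem exists_normalFactorization {n : ℕ}
    (C : AddCon (minimalGenerators (recursiveFamily n) →₀ ℕ))
    (hC : ∀ i < n, C (recursiveRelation n i).1 (recursiveRelation n i).2)
    (a : minimalGenerators (recursiveFamily n) →₀ ℕ) :
    ∃ c, ∃ S ⊆ Finset.range n, C a (normalFactorization n c S) := by
  -- Here `m` is the number of digits above `i`, through which a carry can still propagate.
  have hadd : ∀ m i, i + m + 1 = n → ∀ c, ∀ S ⊆ Finset.range n, ∃ d, ∃ T ⊆ Finset.range n,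
      C (generatorExponent (recursiveFamily n) (2 ^ n + 2 ^ i) + normalFactorization n c S)
        (normalFactorization n d T) := by
    intro m
    induction m with
    | zero =>
      intro i hi c S hS
      by_cases hiS : i ∈ S
      · refine ⟨c + 3, S.erase i, (Finset.erase_subset _ _).trans hS, ?_⟩
        have h1 := hC i (by omega)
        simp only [recursiveRelation, if_pos (show i + 1 = n by omega)] at h1
        have h2 := C.add h1 (C.refl (normalFactorization n c (S.erase i)))
        convert h2 using 1
        · simp only [normalFactorization]
          rw [← Finset.add_sum_erase _ _ hiS, two_nsmul]
          abel
        · simp only [normalFactorization, add_smul]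
          abel
      · refine ⟨c, insert i S, Finset.insert_subset (Finset.mem_range.2 (by omega)) hS, ?_⟩
        convert C.refl _ using 1
        simp only [normalFactorization, Finset.sum_insert hiS]
        abel
    | succ m ih =>
      intro i hi c S hS
      by_cases hiS : i ∈ S
      · obtain ⟨d, T, hT, h⟩ := ih (i + 1) (by omega) (c + 1) (S.erase i)
          ((Finset.erase_subset _ _).trans hS)
        refine ⟨d, T, hT, C.trans ?_ h⟩
        have h1 := hC i (by omega)
        simp only [recursiveRelation, if_neg (show i + 1 ≠ n by omega)] at h1
        have h2 := C.add h1 (C.refl (normalFactorization n c (S.erase i)))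
        convert h2 using 1
        · simp only [normalFactorization]
          rw [← Finset.add_sum_erase _ _ hiS, two_nsmul]
          abel
        · simp only [normalFactorization, add_smul, one_smul]
          abel
      · refine ⟨c, insert i S, Finset.insert_subset (Finset.mem_range.2 (by omega)) hS, ?_⟩
        convert C.refl _ using 1
        simp only [normalFactorization, Finset.sum_insert hiS]
        abel
  have hgen : ∀ (x : minimalGenerators (recursiveFamily n)) (c : ℕ), ∀ S ⊆ Finset.range n,
      ∃ d, ∃ T ⊆ Finset.range n,
        C (Finsupp.single x 1 + normalFactorization n c S) (normalFactorization n d T) := by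
    intro x c S hS
    have hx : Finsupp.single x 1 = generatorExponent (recursiveFamily n) x := by
      rw [generatorExponent, dif_pos x.2]
    have hx' : (x : ℕ) ∈ recursiveGenerators n :=
      (minimalGenerators_recursiveFamily n).le x.2
    rw [hx]
    simp only [recursiveGenerators, Finset.mem_insert, Finset.mem_image, Finset.mem_range] at hx'
    rcases hx' with h | ⟨i, hi, h⟩
    · refine ⟨c + 1, S, hS, ?_⟩
      rw [h]
      convert C.refl _ using 1
      simp only [normalFactorization, add_smul, one_smul]
      abel
    · rw [← h]
      exact hadd (n - 1 - i) i (by omega) c S hS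
  have hmul : ∀ (x : minimalGenerators (recursiveFamily n)) (k c : ℕ), ∀ S ⊆ Finset.range n,
      ∃ d, ∃ T ⊆ Finset.range n,
        C (Finsupp.single x k + normalFactorization n c S) (normalFactorization n d T) := by
    intro x k
    induction k with
    | zero => exact fun c S hS => ⟨c, S, hS, by
      rw [Finsupp.single_zero, zero_add]; exact C.refl _⟩
    | succ k ih =>
      intro c S hS
      obtain ⟨d, T, hT, h⟩ := hgen x c S hS
      obtain ⟨d', T', hT', h'⟩ := ih d T hT
      refine ⟨d', T', hT', C.trans ?_ h'⟩
      rw [Finsupp.single_add, add_assoc]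
      exact C.add (C.refl _) h
  induction a using Finsupp.induction with
  | zero => exact ⟨0, ∅, Finset.empty_subset _, by
    simpa [normalFactorization] using C.refl 0⟩
  | single_add x k a _ _ ih =>
    obtain ⟨c, S, hS, h⟩ := ih
    obtain ⟨d, T, hT, h'⟩ := hmul x k c S hS
    exact ⟨d, T, hT, C.trans (C.add (C.refl _) h) h'⟩

/-- Two factorizations of one element reduce to normal forms of the same value, which coincide. -/
theorem isPresentation_recursiveRelation (n : ℕ) :
    IsPresentation (recursiveFamily n) (recursiveRelation n '' Set.Iio n) := by
  have hle : addConGen (fun a b => (a, b) ∈ recursiveRelation n '' Set.Iio n) ≤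
      AddCon.ker (factorizationHom (recursiveFamily n)) := by
    rw [AddCon.addConGen_le]
    rintro a b ⟨i, hi, hab⟩
    rw [Set.mem_Iio] at hi
    obtain ⟨rfl, rfl⟩ := Prod.mk.inj hab
    change factorizationHom _ _ = factorizationHom _ _
    rw [map_nsmul, factorizationHom_pow_add_pow hi]
    split_ifs with h
    · rw [map_nsmul, factorizationHom_pow, smul_eq_mul, smul_eq_mul, ← h]
      ring
    · rw [map_add, factorizationHom_pow, factorizationHom_pow_add_pow (by omega), smul_eq_mul]
      ring
  refine le_antisymm hle fun {a b} hab => ?_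
  have hC : ∀ i < n, addConGen (fun a b => (a, b) ∈ recursiveRelation n '' Set.Iio n)
      (recursiveRelation n i).1 (recursiveRelation n i).2 := fun i hi =>
    AddConGen.Rel.of _ _ ⟨i, hi, rfl⟩
  obtain ⟨c, S, hS, h1⟩ := exists_normalFactorization _ hC a
  obtain ⟨d, T, hT, h2⟩ := exists_normalFactorization _ hC b
  have e : normalFactorization n c S = normalFactorization n d T :=
    normalFactorization_injective hS hT
      (Eq.trans (Eq.symm (hle h1)) (Eq.trans hab (hle h2)))
  exact AddCon.trans _ h1 (e ▸ AddCon.symm _ h2)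

/-- The explicit presentation has at most `n` elements and every finite presentation has at least
`n`. This gives both the count and the minimality. -/
theorem isCompleteIntersection_recursiveFamily (n : ℕ) :
    IsCompleteIntersection (recursiveFamily n) := by
  have hfin : (recursiveRelation n '' Set.Iio n).Finite := (Set.finite_Iio n).image _
  have hcard : (recursiveRelation n '' Set.Iio n).ncard ≤ n := by
    refine (Set.ncard_image_le (Set.finite_Iio n)).trans ?_
    rw [Set.ncard_eq_toFinset_card']
    simp
  have hlow : ∀ {ρ}, IsPresentation (recursiveFamily n) ρ → ρ.Finite → n ≤ ρ.ncard := by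
    intro ρ h hρ
    have := h.embeddingDimension_le hρ
    rw [embeddingDimension_recursiveFamily] at this
    omega
  have hpres := isPresentation_recursiveRelation n
  refine ⟨isNumericalSemigroup_recursiveFamily n, _, ⟨hpres, fun ρ hρ hle => ?_⟩, ?_⟩
  · exact (Set.eq_of_subset_of_ncard_le hle
      (hcard.trans (hlow hρ (hfin.subset hle))) hfin).ge
  · rw [← hfin.cast_ncard_eq, le_antisymm hcard (hlow hpres hfin),
      embeddingDimension_recursiveFamily]
    rfl

/-- The lower bound is the general inequality, applied to this complete intersection. -/
theorem semigroupConductor_recursiveFamily (n : ℕ) :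
    semigroupConductor (recursiveFamily n) = n * 2 ^ n := by
  refine le_antisymm (Nat.sInf_le (mem_recursiveFamily_of_le n)) ?_
  have := (isCompleteIntersection_recursiveFamily n).conductor_bound.1
  rwa [embeddingDimension_recursiveFamily, Nat.add_sub_cancel] at this

theorem proposition2p8 :
    (∀ Γ : AddSubmonoid ℕ, IsCompleteIntersection Γ →
      (embeddingDimension Γ - 1) * 2 ^ (embeddingDimension Γ - 1) ≤ semigroupConductor Γ) ∧
    (∀ Γ : AddSubmonoid ℕ, IsCompleteIntersection Γ →
      ((embeddingDimension Γ - 1) * 2 ^ (embeddingDimension Γ - 1) = semigroupConductor Γ ↔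
        ∃ n : ℕ, Γ = recursiveFamily n)) ∧
    (∀ n : ℕ, IsCompleteIntersection (recursiveFamily n) ∧
      embeddingDimension (recursiveFamily n) = n + 1 ∧
      semigroupConductor (recursiveFamily n) = n * 2 ^ n) := by
  refine ⟨fun Γ h => h.conductor_bound.1, fun Γ h => ⟨fun e => ⟨_, h.conductor_bound.2 e⟩, ?_⟩,
    fun n => ⟨isCompleteIntersection_recursiveFamily n, embeddingDimension_recursiveFamily n,
      semigroupConductor_recursiveFamily n⟩⟩
  rintro ⟨n, rfl⟩
  rw [embeddingDimension_recursiveFamily, semigroupConductor_recursiveFamily, Nat.add_sub_cancel]
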